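/- **Setting.** Let $X,Y$ be (real or complex) Hilbert spaces, $F:D(F)\subset X\to Y$ Fréchet differentiable, $x^\dagger\in D(F)$, $y=F(x^\dagger)$, $x_0\in X$. Let $g_\alpha$ ($\alpha>0$) be real functions, continuous on $[0,1/2]$, put $r_\alpha(\lambda)=1-\lambda g_\alpha(\lambda)$, let $(\alpha_k)_{k\ge0}$ be real numbers, and let $r>1$, $\tau>1$, $c_0,\dots,c_6>0$ with $c_5>1$. Functions of $A^*A$ are understood in the sense of the continuous functional calculus. Assume: 1. For all $\alpha>0$, $\lambda\in[0,1/2]$: $0<r_\alpha(\lambda)\le1$, $r_\alpha(\lambda)\lambda\le c_0\alpha$, $0\le g_\alpha(\lambda)\le c_1\alpha^{-1}$, $r_\alpha(\lambda)\lambda^{1/2}\le c_3\alpha^{1/2}$ and $g_\alpha(\lambda)\lambda^{1/2}\le c_4\alpha^{-1/2}$, where $c_3\le c_0^{1/2}$, $c_4\le c_1^{1/2}$; and for $0<\alpha\le\beta$, $\lambda\in[0,1/2]$: $r_\alpha(\lambda)\le r_\beta(\lambda)$ and $r_\beta(\lambda)-r_\alpha(\lambda)\le c_2\sqrt{\lambda/\alpha}\,r_\beta(\lambda)$.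 2. $\alpha_k>0$, $1\le\alpha_k/\alpha_{k+1}\le r$, $\alpha_k\to0$, and $r_{\alpha_k}(\lambda)\le c_5r_{\alpha_{k+1}}(\lambda)$ for all $k$ and $\lambda\in[0,1/2]$. 3. For all $\alpha>0$ and all bounded linear $A,B:X\to Y$ with $\|A\|,\|B\|\le1/\sqrt2$: $\|r_\alpha(A^*A)-r_\alpha(B^*B)\|\le c_6\alpha^{-1/2}\|A-B\|$, $\|[r_\alpha(A^*A)-r_\alpha(B^*B)]B^*\|\le c_6\|A-B\|$, $\|A[r_\alpha(A^*A)-r_\alpha(B^*B)]B^*\|\le c_6\alpha^{1/2}\|A-B\|$, $\|[g_\alpha(A^*A)-g_\alpha(B^*B)]B^*\|\le c_6\alpha^{-1}\|A-B\|$. 4. $\rho>0$, the open ball $B_\rho(x^\dagger)$ lies in $D(F)$, $\rho>4\|x_0-x^\dagger\|$, and for all $x,z\in B_\rho(x^\dagger)$: $\|F'(x)\|\le\min\{c_3\alpha_0^{1/2},\beta_0^{1/2}\}$ and $\|F'(x)-F'(z)\|\le L\|x-z\|$, where $0<\beta_0\le1/2$ is such that $r_{\alpha_0}\ge3/4$ on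 $[0,\beta_0]$. Let $\bar\nu\in[1,\infty]$ be the qualification of $\{g_\alpha\}$: the largest number such that for each finite $0\le\mu\le\bar\nu$ there is $d_\mu>0$ with $r_\alpha(\lambda)\lambda^\mu\le d_\mu\alpha^\mu$ for all $\alpha>0$, $\lambda\in[0,1/2]$. For data $y^\delta\in Y$ with $\|y^\delta-y\|\le\delta$, $\delta>0$, let $x_0^\delta=x_0$ and $$x_{k+1}^\delta=x_0-g_{\alpha_k}\bigl(F'(x_k^\delta)^*F'(x_k^\delta)\bigr)F'(x_k^\delta)^*\bigl(F(x_k^\delta)-y^\delta-F'(x_k^\delta)(x_k^\delta-x_0)\bigr),$$ and let $k_\delta$ be the first integer with $\|F(x_{k_\delta}^\delta)-y^\delta\|\le\tau\delta<\|F(x_k^\delta)-y^\delta\|$, $0\le k<k_\delta$. **Theorem.** There are $\eta_0,\kappa>0$ depending only on $r,\tau,c_0,\dots,c_6$, and for each $\nu\ge 1/2$ a constant $C_\nu>0$ depending only on $r,\tau,\nu,c_0,\dots,c_6$ and the qualification constant $d_{\nu+1/2}$, such that the following holds in the above setting. Let $1/2\le\nu\le\bar\nu-1/2$ and $x_0-x^\dagger=(F'(x^\dagger)^*F'(x^\dagger))^\nu\omega$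 with $\omega\in X$. Then there is a unique $u\in\mathcal N(F'(x^\dagger)^*)^\perp\subset Y$ with $x_0-x^\dagger=F'(x^\dagger)^*u$, and if $L\|u\|\le\eta_0$, then for all $\delta>0$ and all $y^\delta$ with $\|y^\delta-y\|\le\delta$: (i) if $\delta$ is so small that $\|u\|\,\delta\le\kappa\rho^2$, then $k_\delta$ exists and $x_k^\delta\in B_\rho(x^\dagger)$ for $0\le k\le k_\delta$; (ii) whenever $k_\delta$ exists and $x_k^\delta\in B_\rho(x^\dagger)$ for $0\le k\le k_\delta$ (in particular for all sufficiently small $\delta$, by (i)), $$\|x_{k_\delta}^\delta-x^\dagger\|\le C_\nu\,\|\omega\|^{1/(1+2\nu)}\,\delta^{2\nu/(1+2\nu)}.$$ -/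

import Mathlib

open scoped InnerProductSpace

namespace NewtonReg

section FunctionalCalculus

variable {𝕜 X : Type*} [RCLike 𝕜] [NormedAddCommGroup X] [InnerProductSpace 𝕜 X]

/-- `p(T)` for a real polynomial `p` and a bounded operator `T` on a real or complex space. -/
noncomputable def polyOp (T : X →L[𝕜] X) (p : Polynomial ℝ) : X →L[𝕜] X :=
  Polynomial.aeval T (p.map (algebraMap ℝ 𝕜))

/-- `S = f(T)` for a positive operator `T` (whose spectrum lies in `[0, ‖T‖]`) and a function `f`
continuous on `[0, ‖T‖]`: the operator `S` is the limit, in operator norm, of `p(T)` as the real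
polynomials `p` tend to `f` uniformly on `[0, ‖T‖]`. -/
def IsFunOp (f : ℝ → ℝ) (T S : X →L[𝕜] X) : Prop :=
  ∀ ε > 0, ∃ η > 0, ∀ p : Polynomial ℝ,
    (∀ t ∈ Set.Icc (0 : ℝ) ‖T‖, |p.eval t - f t| ≤ η) → ‖polyOp T p - S‖ ≤ ε

open Classical in
/-- The operator `f(T)` of the continuous functional calculus, for `T` positive and `f` continuous
on `[0, ‖T‖]`; existence and uniqueness in that case are `existsUnique_isFunOp`. -/
noncomputable def funOp (f : ℝ → ℝ) (T : X →L[𝕜] X) : X →L[𝕜] X :=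
  if h : ∃ S, IsFunOp f T S then h.choose else 0

/-! Well-definedness of `funOp`. -/

theorem polyOp_mul (T : X →L[𝕜] X) (p q : Polynomial ℝ) :
    polyOp T (p * q) = polyOp T p * polyOp T q := by
  simp [polyOp]

theorem polyOp_sub (T : X →L[𝕜] X) (p q : Polynomial ℝ) :
    polyOp T (p - q) = polyOp T p - polyOp T q := by
  simp [polyOp]

theorem polyOp_add (T : X →L[𝕜] X) (p q : Polynomial ℝ) :
    polyOp T (p + q) = polyOp T p + polyOp T q := by
  simp [polyOp]

theorem polyOp_C (T : X →L[𝕜] X) (c : ℝ) (x : X) :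
    polyOp T (Polynomial.C c) x = (c : 𝕜) • x := by
  simp [polyOp, Algebra.algebraMap_eq_smul_one]

theorem polyOp_X (T : X →L[𝕜] X) : polyOp T Polynomial.X = T := by
  simp [polyOp]

theorem exists_polynomial_near {f : ℝ → ℝ} {b : ℝ} (hf : ContinuousOn f (Set.Icc 0 b))
    {η : ℝ} (hη : 0 < η) :
    ∃ p : Polynomial ℝ, ∀ t ∈ Set.Icc (0 : ℝ) b, |p.eval t - f t| ≤ η := by
  obtain ⟨p, hp⟩ := exists_polynomial_near_of_continuousOn 0 b f hf η hη
  exact ⟨p, fun t ht => (hp t ht).le⟩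

theorem IsFunOp.unique {T : X →L[𝕜] X} {f : ℝ → ℝ} (hf : ContinuousOn f (Set.Icc 0 ‖T‖))
    {S S' : X →L[𝕜] X} (h : IsFunOp f T S) (h' : IsFunOp f T S') : S = S' := by
  rw [← sub_eq_zero, ← norm_le_zero_iff]
  refine le_of_forall_pos_le_add fun ε hε => ?_
  obtain ⟨η, hη, hS⟩ := h (ε / 2) (by positivity)
  obtain ⟨η', hη', hS'⟩ := h' (ε / 2) (by positivity)
  obtain ⟨p, hp⟩ := exists_polynomial_near hf (lt_min hη hη')
  have h1 := hS p fun t ht => (hp t ht).trans (min_le_left _ _)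
  have h2 := hS' p fun t ht => (hp t ht).trans (min_le_right _ _)
  calc ‖S - S'‖ = ‖(polyOp T p - S') - (polyOp T p - S)‖ := by congr 1; abel
    _ ≤ _ := norm_sub_le _ _
    _ ≤ 0 + ε := by linarith


theorem isSelfAdjoint_polyOp [CompleteSpace X] {T : X →L[𝕜] X} (hT : IsSelfAdjoint T) (p : Polynomial ℝ) :
    IsSelfAdjoint (polyOp T p) := by
  induction p using Polynomial.induction_on' with
  | add p q hp hq => rw [polyOp_add]; exact hp.add hq
  | monomial n a =>
    have : polyOp T (Polynomial.monomial n a) = (a : 𝕜) • T ^ n := by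
      rw [polyOp, Polynomial.map_monomial, Polynomial.aeval_monomial,
        Algebra.algebraMap_eq_smul_one, smul_mul_assoc, one_mul]
    rw [this]
    refine IsSelfAdjoint.smul ?_ (hT.pow n)
    simp [IsSelfAdjoint]

/-- A real polynomial without zeros on `[0, ‖T‖]` is bounded below at a positive operator. -/
theorem polyOp_boundedBelow {T : X →L[𝕜] X} (hT : T.IsPositive) (q : Polynomial ℝ) :
    (∀ t ∈ Set.Icc (0 : ℝ) ‖T‖, q.eval t ≠ 0) → ∃ m > 0, ∀ x, m * ‖x‖ ≤ ‖polyOp T q x‖ := by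
  have key : ∀ (S : X →L[𝕜] X) (m : ℝ), (∀ x, m * ‖x‖ ^ 2 ≤ |RCLike.re ⟪S x, x⟫_𝕜|) →
      ∀ x, m * ‖x‖ ≤ ‖S x‖ := by
    intro S m h x
    rcases eq_or_ne x 0 with rfl | hx
    · simp
    have hx' : 0 < ‖x‖ := norm_pos_iff.2 hx
    have h1 : |RCLike.re ⟪S x, x⟫_𝕜| ≤ ‖S x‖ * ‖x‖ :=
      (RCLike.abs_re_le_norm _).trans (norm_inner_le_norm _ _)
    have := (h x).trans h1
    nlinarith
  induction q using UniqueFactorizationMonoid.induction_on_prime with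
  | h₁ => intro h; exact absurd (h 0 ⟨le_rfl, norm_nonneg _⟩) (by simp)
  | h₂ q hq =>
    intro _
    obtain ⟨c, hc, rfl⟩ := Polynomial.isUnit_iff.1 hq
    refine ⟨|c|, abs_pos.2 hc.ne_zero, fun x => ?_⟩
    rw [polyOp_C, norm_smul]; simp
  | h₃ q p hq hp ih =>
    intro h
    obtain ⟨m, hm, ihm⟩ := ih (fun t ht h0 => h t ht (by simp [h0]))
    have hroot : ∀ t ∈ Set.Icc (0 : ℝ) ‖T‖, p.eval t ≠ 0 := fun t ht h0 => h t ht (by simp [h0])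
    suffices ∃ m > 0, ∀ x, m * ‖x‖ ≤ ‖polyOp T p x‖ by
      obtain ⟨m', hm', h'⟩ := this
      refine ⟨m' * m, by positivity, fun x => ?_⟩
      rw [polyOp_mul]
      calc m' * m * ‖x‖ = m' * (m * ‖x‖) := by ring
        _ ≤ m' * ‖polyOp T q x‖ := by gcongr; exact ihm x
        _ ≤ _ := h' _
    have hirr := hp.irreducible
    have hsym : ∀ x y, ⟪T x, y⟫_𝕜 = ⟪x, T y⟫_𝕜 := fun x y => hT.isSymmetric x y
    obtain ⟨a, b, c, hp2⟩ : ∃ a b c : ℝ, p = Polynomial.C a * Polynomial.X ^ 2 +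
        Polynomial.C b * Polynomial.X + Polynomial.C c :=
      ⟨_, _, _, Polynomial.eq_quadratic_of_degree_le_two hirr.degree_le_two⟩
    have hval : ∀ t, p.eval t = a * t ^ 2 + b * t + c := by intro t; simp [hp2]
    have hform : ∀ x, RCLike.re ⟪polyOp T p x, x⟫_𝕜
        = a * ‖T x‖ ^ 2 + b * RCLike.re ⟪T x, x⟫_𝕜 + c * ‖x‖ ^ 2 := by
      intro x
      have e : polyOp T p x = (a : 𝕜) • T (T x) + (b : 𝕜) • T x + (c : 𝕜) • x := by
        rw [hp2, polyOp_add, polyOp_add, polyOp_mul, polyOp_mul, pow_two, polyOp_mul, polyOp_X]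
        simp [polyOp_C]
      rw [e, inner_add_left, inner_add_left, inner_smul_left, inner_smul_left, inner_smul_left,
        hsym (T x) x]
      simp only [map_add, RCLike.conj_ofReal, RCLike.re_ofReal_mul, inner_self_eq_norm_sq, hsym]
      rw [← hsym x (T x), inner_self_eq_norm_sq]
    have hq0 : ∀ x, 0 ≤ RCLike.re ⟪T x, x⟫_𝕜 := fun x => hT.re_inner_nonneg_left x
    have hT1 : ∀ x, ‖T x‖ ≤ ‖T‖ * ‖x‖ := T.le_opNorm
    have hq1 : ∀ x, RCLike.re ⟪T x, x⟫_𝕜 ≤ ‖T x‖ * ‖x‖ := fun x =>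
      (RCLike.re_le_norm _).trans (norm_inner_le_norm _ _)
    rcases eq_or_ne a 0 with rfl | ha
    · have h0 := hroot 0 ⟨le_rfl, norm_nonneg _⟩
      have h1 := hroot ‖T‖ ⟨norm_nonneg _, le_rfl⟩
      have hB := norm_nonneg T
      simp only [hval] at h0 h1
      have hc0 : c ≠ 0 := by simpa using h0
      have hcc : 0 < c * c := mul_self_pos.2 hc0
      have hsign : 0 < c * (c + b * ‖T‖) := by
        by_contra hcon
        have hcb : c * (b * ‖T‖) < 0 := by nlinarith
        have hb : b ≠ 0 := by rintro rfl; simp at hcb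
        have hbc : c * b < 0 := by nlinarith
        have hbb : 0 < b * b := mul_self_pos.2 hb
        refine hroot (-c / b) ⟨?_, ?_⟩ (by rw [hval]; field_simp; ring)
        · rw [show -c / b = -(c * b) / (b * b) by field_simp]
          exact div_nonneg (by linarith) hbb.le
        · rw [show -c / b = -(c * c) / (c * b) by field_simp]
          rw [div_le_iff_of_neg hbc]
          nlinarith
      have hmin : 0 < min (c * c) (c * (c + b * ‖T‖)) := lt_min hcc hsign
      refine ⟨min (c * c) (c * (c + b * ‖T‖)) / |c|, by positivity, key _ _ fun x => ?_⟩
      rw [hform]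
      have hs0 := hq0 x
      have hs1 : RCLike.re ⟪T x, x⟫_𝕜 ≤ ‖T‖ * ‖x‖ ^ 2 :=
        (hq1 x).trans (by nlinarith [hT1 x, norm_nonneg x])
      generalize RCLike.re ⟪T x, x⟫_𝕜 = s at hs0 hs1 ⊢
      have h4 : min (c * c) (c * (c + b * ‖T‖)) * ‖x‖ ^ 2 ≤
          c * (0 * ‖T x‖ ^ 2 + b * s + c * ‖x‖ ^ 2) := by
        rcases le_total 0 (c * b) with hcb | hcb
        · have := mul_le_mul_of_nonneg_right (min_le_left (c * c) (c * (c + b * ‖T‖)))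
            (sq_nonneg ‖x‖)
          nlinarith [mul_nonneg hcb hs0]
        · have := mul_le_mul_of_nonneg_right (min_le_right (c * c) (c * (c + b * ‖T‖)))
            (sq_nonneg ‖x‖)
          nlinarith [mul_le_mul_of_nonpos_left hs1 hcb]
      have h5 := h4.trans (le_abs_self _)
      rw [abs_mul] at h5
      rw [div_mul_eq_mul_div, div_le_iff₀ (by positivity)]
      linarith
    · have hdisc : 0 < 4 * a * c - b ^ 2 := by
        by_contra hcon
        have hsq : Real.sqrt (b ^ 2 - 4 * a * c) ^ 2 = b ^ 2 - 4 * a * c :=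
          Real.sq_sqrt (by linarith)
        have hr : p.IsRoot ((-b + Real.sqrt (b ^ 2 - 4 * a * c)) / (2 * a)) := by
          rw [Polynomial.IsRoot, hval]
          generalize Real.sqrt (b ^ 2 - 4 * a * c) = w at hsq
          field_simp
          linear_combination hsq
        have h1 := Polynomial.degree_eq_one_of_irreducible_of_root hirr hr
        rw [hp2, Polynomial.degree_quadratic ha] at h1
        exact absurd h1 (by decide)
      refine ⟨(4 * a * c - b ^ 2) / (4 * |a|), by positivity, key _ _ fun x => ?_⟩
      rcases eq_or_ne x 0 with rfl | hx
      · simp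
      have hx' : 0 < ‖x‖ := norm_pos_iff.2 hx
      rw [hform]
      have hss : RCLike.re ⟪T x, x⟫_𝕜 ^ 2 ≤ (‖T x‖ * ‖x‖) ^ 2 :=
        pow_le_pow_left₀ (hq0 x) (hq1 x) 2
      generalize RCLike.re ⟪T x, x⟫_𝕜 = s at hss ⊢
      have h4 : (4 * a * c - b ^ 2) * ‖x‖ ^ 2 ≤
          4 * a * (a * ‖T x‖ ^ 2 + b * s + c * ‖x‖ ^ 2) := by
        have hx2 : 0 < ‖x‖ ^ 2 := by positivity
        refine le_of_mul_le_mul_right ?_ hx2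
        nlinarith [sq_nonneg (2 * a * s + b * ‖x‖ ^ 2), mul_le_mul_of_nonneg_left hss (sq_nonneg a)]
      have h5 := h4.trans (le_abs_self _)
      rw [abs_mul, abs_mul, abs_of_pos (by norm_num : (0 : ℝ) < 4)] at h5
      rw [div_mul_eq_mul_div, div_le_iff₀ (by positivity)]
      linarith

/-- `‖p(T)‖ ≤ sup |p|` over `[0, ‖T‖]`, for a positive operator `T`. -/
theorem norm_polyOp_le [CompleteSpace X] {T : X →L[𝕜] X} (hT : T.IsPositive) (p : Polynomial ℝ) {M : ℝ}
    (hM : ∀ t ∈ Set.Icc (0 : ℝ) ‖T‖, |p.eval t| ≤ M) : ‖polyOp T p‖ ≤ M := by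
  have hM0 : 0 ≤ M := (abs_nonneg _).trans (hM 0 ⟨le_rfl, norm_nonneg _⟩)
  by_contra! hlt
  set S := polyOp T p with hS
  have hSs : IsSelfAdjoint S := isSelfAdjoint_polyOp hT.isSelfAdjoint p
  have hsym : ∀ x y, ⟪S x, y⟫_𝕜 = ⟪x, S y⟫_𝕜 := fun x y => hSs.isSymmetric x y
  obtain ⟨m, hm, hb⟩ := polyOp_boundedBelow hT (p * p - Polynomial.C (‖S‖ ^ 2)) (by
    intro t ht h0
    have h1 := abs_le.1 (hM t ht)
    simp only [Polynomial.eval_sub, Polynomial.eval_mul, Polynomial.eval_C] at h0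
    nlinarith)
  have hbd : ∀ x, m ^ 2 * ‖x‖ ^ 2 ≤ ‖S‖ ^ 2 * (‖S‖ ^ 2 * ‖x‖ ^ 2 - ‖S x‖ ^ 2) := by
    intro x
    have h1 := hb x
    rw [polyOp_sub, polyOp_mul, sub_apply, polyOp_C] at h1
    have h2 : ‖S (S x) - ((‖S‖ ^ 2 : ℝ) : 𝕜) • x‖ ^ 2
        = ‖S (S x)‖ ^ 2 - 2 * (‖S‖ ^ 2 * ‖S x‖ ^ 2) + (‖S‖ ^ 2 * ‖x‖) ^ 2 := by
      rw [norm_sub_sq (𝕜 := 𝕜), inner_smul_right, norm_smul, hsym,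
        RCLike.re_ofReal_mul, inner_self_eq_norm_sq, RCLike.norm_ofReal,
        abs_of_nonneg (sq_nonneg _)]
    have h3 : ‖S (S x)‖ ≤ ‖S‖ * ‖S x‖ := S.le_opNorm _
    have h4 := pow_le_pow_left₀ (by positivity) h1 2
    have h5 := pow_le_pow_left₀ (norm_nonneg _) h3 2
    change (m * ‖x‖) ^ 2 ≤ ‖S (S x) - ((‖S‖ ^ 2 : ℝ) : 𝕜) • x‖ ^ 2 at h4
    rw [h2] at h4
    nlinarith
  have hSpos : 0 < ‖S‖ := hM0.trans_lt hlt
  set k := Real.sqrt (‖S‖ ^ 2 - m ^ 2 / ‖S‖ ^ 2) with hk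
  have hkS : ‖S‖ ≤ k := by
    refine S.opNorm_le_bound (Real.sqrt_nonneg _) fun x => ?_
    rw [hk, ← Real.sqrt_sq (norm_nonneg x), ← Real.sqrt_mul' _ (sq_nonneg _)]
    refine Real.le_sqrt_of_sq_le ?_
    have := hbd x
    have h6 : m ^ 2 / ‖S‖ ^ 2 * ‖x‖ ^ 2 ≤ ‖S‖ ^ 2 * ‖x‖ ^ 2 - ‖S x‖ ^ 2 := by
      rw [div_mul_eq_mul_div, div_le_iff₀ (by positivity)]; linarith
    linarith
  have : k < ‖S‖ := by
    rw [hk, Real.sqrt_lt' hSpos]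
    have : 0 < m ^ 2 / ‖S‖ ^ 2 := by positivity
    linarith
  linarith

/-- The continuous functional calculus is well defined. -/
theorem existsUnique_isFunOp [CompleteSpace X] {T : X →L[𝕜] X} (hT : T.IsPositive) {f : ℝ → ℝ}
    (hf : ContinuousOn f (Set.Icc 0 ‖T‖)) : ∃! S, IsFunOp f T S := by
  choose p hp using fun n : ℕ => exists_polynomial_near hf (η := 1 / ((n : ℝ) + 1)) (by positivity)
  have hdist : ∀ (q : Polynomial ℝ) (η : ℝ), (∀ t ∈ Set.Icc (0 : ℝ) ‖T‖, |q.eval t - f t| ≤ η) →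
      ∀ n, ‖polyOp T q - polyOp T (p n)‖ ≤ η + 1 / ((n : ℝ) + 1) := by
    intro q η hq n
    rw [← polyOp_sub]
    refine norm_polyOp_le hT _ fun t ht => ?_
    rw [Polynomial.eval_sub, show q.eval t - (p n).eval t
      = (q.eval t - f t) - ((p n).eval t - f t) by ring]
    exact (abs_sub _ _).trans (add_le_add (hq t ht) (hp n t ht))
  have hlim := tendsto_one_div_add_atTop_nhds_zero_nat (𝕜 := ℝ)
  have hC : CauchySeq fun n => polyOp T (p n) := by
    refine cauchySeq_of_le_tendsto_0 (fun n : ℕ => 1 / ((n : ℝ) + 1) + 1 / ((n : ℝ) + 1)) ?_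
      (by simpa using hlim.add hlim)
    intro n k N hn hk
    rw [dist_eq_norm]
    refine (hdist _ _ (hp n) k).trans (add_le_add ?_ ?_)
    · exact Nat.one_div_le_one_div hn
    · exact Nat.one_div_le_one_div hk
  obtain ⟨S, hS⟩ := cauchySeq_tendsto_of_complete hC
  have hfun : IsFunOp f T S := by
    intro ε hε
    refine ⟨ε, hε, fun q hq => ?_⟩
    have h1 : Filter.Tendsto (fun n => ‖polyOp T q - polyOp T (p n)‖) Filter.atTop
        (nhds ‖polyOp T q - S‖) := (tendsto_const_nhds.sub hS).norm
    have h2 := hlim.const_add ε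
    rw [add_zero] at h2
    exact le_of_tendsto_of_tendsto' h1 h2 (hdist q ε hq)
  exact ⟨S, hfun, fun S' hS' => hS'.unique hf hfun⟩

theorem funOp_spec [CompleteSpace X] {T : X →L[𝕜] X} (hT : T.IsPositive) {f : ℝ → ℝ}
    (hf : ContinuousOn f (Set.Icc 0 ‖T‖)) : IsFunOp f T (funOp f T) := by
  have h : ∃ S, IsFunOp f T S := (existsUnique_isFunOp hT hf).exists
  rw [funOp, dif_pos h]
  exact h.choose_spec

end FunctionalCalculus

section Generator

/-- The residual function `r_α(lam) = 1 - lam g_α(lam)`. -/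
def residual (g : ℝ → ℝ → ℝ) (α lam : ℝ) : ℝ := 1 - lam * g α lam

/-- The structure conditions on the family `g α`, `α > 0`, on the interval `[0, 1/2]`, with constants
`c 0`, `c 1`, `c 2`, and with constants `c 3 ≤ √(c 0)`, `c 4 ≤ √(c 1)` for the
derived bounds on `r_α(lam) lam^(1/2)` and `g_α(lam) lam^(1/2)`. -/
structure GeneratorConditions (g : ℝ → ℝ → ℝ) (c : Fin 7 → ℝ) : Prop where
  continuousOn : ∀ α > 0, ContinuousOn (g α) (Set.Icc 0 (1 / 2))
  residual_pos : ∀ α > 0, ∀ lam ∈ Set.Icc (0 : ℝ) (1 / 2), 0 < residual g α lam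
  residual_le_one : ∀ α > 0, ∀ lam ∈ Set.Icc (0 : ℝ) (1 / 2), residual g α lam ≤ 1
  residual_mul_le : ∀ α > 0, ∀ lam ∈ Set.Icc (0 : ℝ) (1 / 2), residual g α lam * lam ≤ c 0 * α
  nonneg : ∀ α > 0, ∀ lam ∈ Set.Icc (0 : ℝ) (1 / 2), 0 ≤ g α lam
  le_inv : ∀ α > 0, ∀ lam ∈ Set.Icc (0 : ℝ) (1 / 2), g α lam ≤ c 1 * α⁻¹
  residual_mono : ∀ α β, 0 < α → α ≤ β → ∀ lam ∈ Set.Icc (0 : ℝ) (1 / 2),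
    residual g α lam ≤ residual g β lam
  residual_sub_le : ∀ α β, 0 < α → α ≤ β → ∀ lam ∈ Set.Icc (0 : ℝ) (1 / 2),
    residual g β lam - residual g α lam ≤ c 2 * √(lam / α) * residual g β lam
  residual_mul_sqrt_le : ∀ α > 0, ∀ lam ∈ Set.Icc (0 : ℝ) (1 / 2),
    residual g α lam * √lam ≤ c 3 * √α
  mul_sqrt_le : ∀ α > 0, ∀ lam ∈ Set.Icc (0 : ℝ) (1 / 2), g α lam * √lam ≤ c 4 * (√α)⁻¹
  c3_le : c 3 ≤ √(c 0)
  c4_le : c 4 ≤ √(c 1)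

/-- `r_α(lam) lam^μ ≤ d α^μ` for all `α > 0` and `lam ∈ [0, 1/2]`. -/
def RateBound (g : ℝ → ℝ → ℝ) (μ d : ℝ) : Prop :=
  ∀ α > 0, ∀ lam ∈ Set.Icc (0 : ℝ) (1 / 2), residual g α lam * lam ^ μ ≤ d * α ^ μ

/-- `νbar ∈ [0, ∞]` is the qualification of the linear regularization method given by `g`: the
largest number such that for each finite `0 ≤ μ ≤ νbar` the bound `RateBound g μ d` holds with
some constant `d > 0`. -/
def IsQualification (g : ℝ → ℝ → ℝ) (νbar : ENNReal) : Prop :=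
  IsGreatest {N : ENNReal | ∀ μ : ℝ, 0 ≤ μ → ENNReal.ofReal μ ≤ N → ∃ d > 0, RateBound g μ d} νbar

/-- The conditions on the numbers `α_k`, including the condition relating them to `r_α`. -/
structure StepSizeConditions (g : ℝ → ℝ → ℝ) (α : ℕ → ℝ) (r c5 : ℝ) : Prop where
  pos : ∀ k, 0 < α k
  one_le_ratio : ∀ k, 1 ≤ α k / α (k + 1)
  ratio_le : ∀ k, α k / α (k + 1) ≤ r
  tendsto_zero : Filter.Tendsto α Filter.atTop (nhds 0)
  residual_le : ∀ k, ∀ lam ∈ Set.Icc (0 : ℝ) (1 / 2),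
    residual g (α k) lam ≤ c5 * residual g (α (k + 1)) lam

end Generator

section Operators

variable {𝕜 X Y : Type*} [RCLike 𝕜]
  [NormedAddCommGroup X] [InnerProductSpace 𝕜 X] [CompleteSpace X]
  [NormedAddCommGroup Y] [InnerProductSpace 𝕜 Y] [CompleteSpace Y]

open ContinuousLinearMap (adjoint)

/-- `A*A`. -/
noncomputable def gram (A : X →L[𝕜] Y) : X →L[𝕜] X := adjoint A ∘L A

variable (𝕜 X Y) in
/-- The commutator estimates for `r_α` and `g_α` with constant `c6`. -/
structure CommutatorEstimates (g : ℝ → ℝ → ℝ) (c6 : ℝ) : Prop where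
  residual_sub : ∀ α > 0, ∀ A B : X →L[𝕜] Y, ‖A‖ ≤ 1 / √2 → ‖B‖ ≤ 1 / √2 →
    ‖funOp (residual g α) (gram A) - funOp (residual g α) (gram B)‖ ≤ c6 * (√α)⁻¹ * ‖A - B‖
  residual_sub_comp : ∀ α > 0, ∀ A B : X →L[𝕜] Y, ‖A‖ ≤ 1 / √2 → ‖B‖ ≤ 1 / √2 →
    ‖(funOp (residual g α) (gram A) - funOp (residual g α) (gram B)) ∘L adjoint B‖
      ≤ c6 * ‖A - B‖
  comp_residual_sub_comp : ∀ α > 0, ∀ A B : X →L[𝕜] Y, ‖A‖ ≤ 1 / √2 → ‖B‖ ≤ 1 / √2 →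
    ‖A ∘L (funOp (residual g α) (gram A) - funOp (residual g α) (gram B)) ∘L adjoint B‖
      ≤ c6 * √α * ‖A - B‖
  sub_comp : ∀ α > 0, ∀ A B : X →L[𝕜] Y, ‖A‖ ≤ 1 / √2 → ‖B‖ ≤ 1 / √2 →
    ‖(funOp (g α) (gram A) - funOp (g α) (gram B)) ∘L adjoint B‖ ≤ c6 * α⁻¹ * ‖A - B‖

/-- The Newton type iterates
`x_{k+1} = x_0 - g_{α_k}(F'(x_k)* F'(x_k)) F'(x_k)* (F(x_k) - y - F'(x_k)(x_k - x_0))`. -/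
noncomputable def newtonIter (g : ℝ → ℝ → ℝ) (α : ℕ → ℝ) (F : X → Y) (F' : X → X →L[𝕜] Y)
    (x₀ : X) (y : Y) : ℕ → X
  | 0 => x₀
  | k + 1 =>
    let x := newtonIter g α F F' x₀ y k
    x₀ - funOp (g (α k)) (gram (F' x)) (adjoint (F' x) (F x - y - F' x (x - x₀)))

end Operators

/-- `k` is the first index at which the discrepancy `‖F(x_k) - y‖` is at most `τ δ`. -/
def IsDiscrepancyIndex {X Y : Type*} [NormedAddCommGroup Y] (F : X → Y) (x : ℕ → X) (y : Y)
    (τ δ : ℝ) (k : ℕ) : Prop :=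
  ‖F (x k) - y‖ ≤ τ * δ ∧ ∀ j < k, τ * δ < ‖F (x j) - y‖

end NewtonReg

/-!
The error of the Newton iteration obeys `e_{k+1} = r_k(B*B) e₀ - g_k(B*B) B* (noise + remainder)`
with `B = F'(x_k)`, and the remainder is at most `L ‖e_k‖ ^ 2`. With `A = F'(xdag)` and
`e₀ = A* u`, the commutator estimates replace `B` by `A` in the filter at the cost of
`L ‖u‖ ‖e_k‖`. The proof rests on the smallness of `η = L ‖u‖` and has three parts.

*A priori bound.* Up to the comparison index, the first `n` with `γ ‖u‖ α_n ≤ δ`, induction gives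
`‖e_k‖ ≤ K √(α_k) ‖u‖` (`norm_newtonIter_sub_le`), so that `L ‖e_k‖ ^ 2 ≤ η K √(α_k) ‖e_k‖` is
always a small perturbation. The noise enters the residual through the contraction
`1 - B g(B*B) B*`; since `τ > 1`, the residual at the comparison index is at most `τ δ`
(`norm_image_newtonIter_sub_le`). So the stopping index does not exceed the comparison index.

*Comparison with the linear problem.* In the same range `‖e_k‖` is bounded by
`‖r_{α_k}(A*A) e₀‖` plus `δ / √(α_k)` (`norm_newtonIter_sub_le_residual`).

*Rate.* At the stopping index `k + 1` put `p = r_k(B*B) e₀`. The discrepancy principle bounds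
`‖B p‖` by a multiple of `δ`: the quadratic remainders are absorbed because
`‖p‖ ^ 2 ≤ ‖u‖ (‖B p‖ + L ‖e_k‖ ‖p‖)`. It is essential to work with `B` here, since the comparison
of `B p` with `A r_k(A*A) e₀` costs a term which `δ` does not dominate. Decreasing the
regularization parameter to any `α ≤ α_k` then costs only a multiple of `δ / √α`, and
`‖r_α(A*A) e₀‖ ≤ (d + 1) α ^ ν ‖ω‖` by the source condition (`norm_newtonIter_succ_sub_le`). If the
value of `α` that balances `α ^ ν ‖ω‖` and `δ / √α` is at most `α_k`, this is the claim; otherwise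
`α = α_k` will do, because the residual exceeded `τ δ` at index `k` and therefore `δ` is at most a
multiple of `α_k ^ (ν + 1/2) ‖ω‖` (`noise_le_of_lt_residual`).

The operator estimates are scalar ones: for a positive operator `T`, `|f| ≤ |h|` on `[0, ‖T‖]`
implies `‖f(T) v‖ ≤ ‖h(T) v‖` for each `v` (`norm_funOp_apply_le`), and
`‖A f(A*A) v‖ = ‖(√t f(t))(A*A) v‖` (`norm_apply_funOp_gram`).
-/

namespace NewtonReg

/-! ### Rules for the functional calculus of a positive operator -/

section Calculus

open Filter Topology Set

variable {𝕜 X : Type*} [RCLike 𝕜] [NormedAddCommGroup X] [InnerProductSpace 𝕜 X]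
  {T : X →L[𝕜] X} {f h : ℝ → ℝ}

theorem exists_polynomial_seq (hf : ContinuousOn f (Icc 0 ‖T‖)) : ∃ p : ℕ → Polynomial ℝ,
    TendstoUniformlyOn (fun n t => (p n).eval t) f atTop (Icc 0 ‖T‖) := by
  choose p hp using fun n : ℕ => exists_polynomial_near hf (η := 1 / ((n : ℝ) + 1)) (by positivity)
  refine ⟨p, Metric.tendstoUniformlyOn_iff.2 fun ε hε => ?_⟩
  filter_upwards [(tendsto_one_div_add_atTop_nhds_zero_nat (𝕜 := ℝ)).eventually
    (gt_mem_nhds hε)] with n hn t ht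
  rw [dist_comm, Real.dist_eq]
  exact (hp n t ht).trans_lt hn

theorem funOp_congr (hfh : EqOn f h (Icc 0 ‖T‖)) : funOp f T = funOp h T := by
  have : IsFunOp f T = IsFunOp h T := by
    funext S
    simp only [IsFunOp, eq_iff_iff]
    refine forall₂_congr fun ε _ => exists_congr fun η => and_congr_right fun _ =>
      forall_congr' fun p => imp_congr_left (forall₂_congr fun t ht => ?_)
    rw [hfh ht]
  rw [funOp, funOp, this]

variable [CompleteSpace X]

/-- If real polynomials tend to `f` uniformly on `[0, ‖T‖]`, then their values at `T` tend to
`f(T)`. All algebraic rules for `funOp` follow from this. -/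
theorem tendsto_funOp (hT : T.IsPositive) (hf : ContinuousOn f (Icc 0 ‖T‖))
    {p : ℕ → Polynomial ℝ}
    (hp : TendstoUniformlyOn (fun n t => (p n).eval t) f atTop (Icc 0 ‖T‖)) :
    Tendsto (fun n => polyOp T (p n)) atTop (𝓝 (funOp f T)) := by
  rw [Metric.tendsto_nhds]
  intro ε hε
  obtain ⟨η, hη, H⟩ := funOp_spec hT hf (ε / 2) (by positivity)
  filter_upwards [Metric.tendstoUniformlyOn_iff.1 hp η hη] with n hn
  rw [dist_eq_norm]
  refine (H _ fun t ht => ?_).trans_lt (by linarith)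
  have := hn t ht
  rw [dist_comm, Real.dist_eq] at this
  exact this.le

theorem funOp_polynomial (hT : T.IsPositive) (p : Polynomial ℝ) :
    funOp (fun t => p.eval t) T = polyOp T p := by
  refine tendsto_nhds_unique (tendsto_funOp hT p.continuous.continuousOn (p := fun _ => p) ?_)
    tendsto_const_nhds
  exact Metric.tendstoUniformlyOn_iff.2 fun ε hε => by simp [hε]

theorem funOp_id (hT : T.IsPositive) : funOp (fun t => t) T = T := by
  simpa [polyOp_X] using funOp_polynomial hT Polynomial.X

theorem funOp_const_apply (hT : T.IsPositive) (a : ℝ) (v : X) :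
    funOp (fun _ => a) T v = (a : 𝕜) • v := by
  have := funOp_polynomial hT (Polynomial.C a)
  simp only [Polynomial.eval_C] at this
  rw [this, polyOp_C]

theorem funOp_sub (hT : T.IsPositive) (hf : ContinuousOn f (Icc 0 ‖T‖))
    (hh : ContinuousOn h (Icc 0 ‖T‖)) :
    funOp (fun t => f t - h t) T = funOp f T - funOp h T := by
  obtain ⟨p, hp⟩ := exists_polynomial_seq hf
  obtain ⟨q, hq⟩ := exists_polynomial_seq hh
  have h1 := (tendsto_funOp hT hf hp).sub (tendsto_funOp hT hh hq)
  refine tendsto_nhds_unique (tendsto_funOp hT (hf.fun_sub hh) (p := fun n => p n - q n) ?_) ?_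
  · simpa using! hp.sub hq
  · simpa [polyOp_sub] using h1

theorem funOp_mul (hT : T.IsPositive) (hf : ContinuousOn f (Icc 0 ‖T‖))
    (hh : ContinuousOn h (Icc 0 ‖T‖)) :
    funOp (fun t => f t * h t) T = funOp f T * funOp h T := by
  obtain ⟨p, hp⟩ := exists_polynomial_seq hf
  obtain ⟨q, hq⟩ := exists_polynomial_seq hh
  have h1 := (tendsto_funOp hT hf hp).mul (tendsto_funOp hT hh hq)
  refine tendsto_nhds_unique (tendsto_funOp hT (hf.fun_mul hh) (p := fun n => p n * q n) ?_) ?_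
  · obtain ⟨M, hM⟩ := isCompact_Icc.exists_bound_of_continuousOn hf
    obtain ⟨N, hN⟩ := isCompact_Icc.exists_bound_of_continuousOn hh
    rw [Metric.tendstoUniformlyOn_iff] at hp hq ⊢
    intro ε hε
    have hMp : 0 ≤ M := (norm_nonneg _).trans (hM 0 ⟨le_rfl, norm_nonneg _⟩)
    have hNp : 0 ≤ N := (norm_nonneg _).trans (hN 0 ⟨le_rfl, norm_nonneg _⟩)
    set η := min 1 (ε / (M + N + 2)) with hη
    have hη0 : 0 < η := by positivity
    have hη1 : η ≤ 1 := min_le_left _ _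
    have hη2 : η * (M + N + 2) ≤ ε := by
      rw [← le_div_iff₀ (by positivity)]; exact min_le_right _ _
    filter_upwards [hp η hη0, hq η hη0] with n hpn hqn t ht
    have e1 := hpn t ht
    have e2 := hqn t ht
    have b1 := hM t ht
    have b2 := hN t ht
    rw [Real.dist_eq] at e1 e2 ⊢
    rw [Real.norm_eq_abs] at b1 b2
    rw [Polynomial.eval_mul, show f t * h t - (p n).eval t * (q n).eval t
      = (f t - (p n).eval t) * h t + f t * (h t - (q n).eval t)
        - (f t - (p n).eval t) * (h t - (q n).eval t) by ring]
    refine (abs_sub _ _).trans_lt ?_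
    have h3 := abs_add_le ((f t - (p n).eval t) * h t) (f t * (h t - (q n).eval t))
    rw [abs_mul, abs_mul] at h3
    rw [abs_mul (f t - (p n).eval t) (h t - (q n).eval t)]
    nlinarith [abs_nonneg (f t), abs_nonneg (h t), abs_nonneg (f t - (p n).eval t),
      abs_nonneg (h t - (q n).eval t)]
  · simpa [polyOp_mul] using h1

theorem isSelfAdjoint_funOp (hT : T.IsPositive) (hf : ContinuousOn f (Icc 0 ‖T‖)) :
    IsSelfAdjoint (funOp f T) := by
  obtain ⟨p, hp⟩ := exists_polynomial_seq hf
  have h1 := tendsto_funOp hT hf hp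
  refine tendsto_nhds_unique (h1.star) (h1.congr fun n => ?_)
  exact (isSelfAdjoint_polyOp hT.isSelfAdjoint (p n)).symm

theorem norm_funOp_le (hT : T.IsPositive) (hf : ContinuousOn f (Icc 0 ‖T‖)) {M : ℝ}
    (hM : ∀ t ∈ Icc 0 ‖T‖, |f t| ≤ M) : ‖funOp f T‖ ≤ M := by
  obtain ⟨p, hp⟩ := exists_polynomial_seq hf
  refine le_of_forall_pos_le_add fun ε hε => ?_
  refine le_of_tendsto (tendsto_funOp hT hf hp).norm ?_
  filter_upwards [Metric.tendstoUniformlyOn_iff.1 hp ε hε] with n hn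
  refine norm_polyOp_le hT _ fun t ht => ?_
  have h1 := hn t ht
  rw [dist_comm, Real.dist_eq] at h1
  have h2 := abs_add_le ((p n).eval t - f t) (f t)
  rw [sub_add_cancel] at h2
  linarith [hM t ht]

theorem inner_funOp_left (hT : T.IsPositive) (hf : ContinuousOn f (Icc 0 ‖T‖)) (v w : X) :
    ⟪funOp f T v, w⟫_𝕜 = ⟪v, funOp f T w⟫_𝕜 :=
  (isSelfAdjoint_funOp hT hf).isSymmetric v w

theorem norm_sq_funOp_apply (hT : T.IsPositive) (hf : ContinuousOn f (Icc 0 ‖T‖)) (v : X) :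
    ‖funOp f T v‖ ^ 2 = RCLike.re ⟪funOp (fun t => f t ^ 2) T v, v⟫_𝕜 := by
  simp only [pow_two (f _)]
  rw [funOp_mul hT hf hf, mul_apply_eq_comp, inner_funOp_left hT hf,
    inner_self_eq_norm_sq]

/-- Functional calculus respects pointwise domination at each vector: `h ^ 2 - f ^ 2` is the
square of a continuous function, hence `‖h(T) v‖ ^ 2 - ‖f(T) v‖ ^ 2 ≥ 0`. -/
theorem norm_funOp_apply_le (hT : T.IsPositive) (hf : ContinuousOn f (Icc 0 ‖T‖))
    (hh : ContinuousOn h (Icc 0 ‖T‖)) (hfh : ∀ t ∈ Icc 0 ‖T‖, |f t| ≤ |h t|) (v : X) :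
    ‖funOp f T v‖ ≤ ‖funOp h T v‖ := by
  have hk : ContinuousOn (fun t => √(h t ^ 2 - f t ^ 2)) (Icc 0 ‖T‖) :=
    ((hh.fun_pow 2).fun_sub (hf.fun_pow 2)).sqrt
  have h1 := norm_sq_funOp_apply hT hk v
  rw [funOp_congr (h := fun t => h t ^ 2 - f t ^ 2)
    (fun t ht => Real.sq_sqrt (by linarith [sq_le_sq.2 (hfh t ht)])),
    funOp_sub hT (hh.fun_pow 2) (hf.fun_pow 2), sub_apply, inner_sub_left, map_sub,
    ← norm_sq_funOp_apply hT hf, ← norm_sq_funOp_apply hT hh] at h1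
  refine le_of_sq_le_sq ?_ (norm_nonneg _)
  nlinarith [sq_nonneg ‖funOp (fun t => √(h t ^ 2 - f t ^ 2)) T v‖]

theorem norm_funOp_apply_le_mul (hT : T.IsPositive) (hf : ContinuousOn f (Icc 0 ‖T‖))
    (hh : ContinuousOn h (Icc 0 ‖T‖)) {a : ℝ} (ha : 0 ≤ a)
    (hfh : ∀ t ∈ Icc 0 ‖T‖, |f t| ≤ a * |h t|) (v : X) :
    ‖funOp f T v‖ ≤ a * ‖funOp h T v‖ := by
  have h1 := norm_funOp_apply_le hT hf (h := fun t => a * h t) (continuousOn_const.fun_mul hh)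
    (fun t ht => by rw [abs_mul, abs_of_nonneg ha]; exact hfh t ht) v
  rwa [funOp_mul hT continuousOn_const hh, mul_apply_eq_comp, funOp_const_apply hT,
    norm_smul, RCLike.norm_ofReal, abs_of_nonneg ha] at h1

theorem norm_funOp_apply_le_of_abs_le (hT : T.IsPositive) (hf : ContinuousOn f (Icc 0 ‖T‖)) {M : ℝ}
    (hM : ∀ t ∈ Icc 0 ‖T‖, |f t| ≤ M) (v : X) : ‖funOp f T v‖ ≤ M * ‖v‖ :=
  (ContinuousLinearMap.le_opNorm _ v).trans
    (mul_le_mul_of_nonneg_right (norm_funOp_le hT hf hM) (norm_nonneg v))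

end Calculus

/-! ### Functions of `A*A` composed with `A` and its adjoint -/

section Gram

open Set
open ContinuousLinearMap (adjoint adjoint_inner_left adjoint_inner_right)

variable {𝕜 X Y : Type*} [RCLike 𝕜]
  [NormedAddCommGroup X] [InnerProductSpace 𝕜 X] [CompleteSpace X]
  [NormedAddCommGroup Y] [InnerProductSpace 𝕜 Y] [CompleteSpace Y]
  (A : X →L[𝕜] Y) {f h : ℝ → ℝ}

theorem isPositive_gram : (gram A).IsPositive :=
  ContinuousLinearMap.isPositive_adjoint_comp_self A

theorem norm_gram : ‖gram A‖ = ‖A‖ ^ 2 := by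
  rw [gram, ContinuousLinearMap.norm_adjoint_comp_self, pow_two]

/-- `‖A f(A*A) v‖ = ‖(√t f(t))(A*A) v‖`, by comparison of the squares. -/
theorem norm_apply_funOp_gram (hf : ContinuousOn f (Icc 0 ‖gram A‖)) (v : X) :
    ‖A (funOp f (gram A) v)‖ = ‖funOp (fun t => √t * f t) (gram A) v‖ := by
  have hT := isPositive_gram A
  have hs : ContinuousOn (fun t : ℝ => √t) (Icc 0 ‖gram A‖) := Real.continuous_sqrt.continuousOn
  have hi : ContinuousOn (fun t : ℝ => t) (Icc 0 ‖gram A‖) := continuousOn_id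
  refine (pow_left_inj₀ (norm_nonneg _) (norm_nonneg _) two_ne_zero).1 ?_
  have e : EqOn (fun t => (√t * f t) ^ 2) (fun t => f t * (t * f t)) (Icc 0 ‖gram A‖) := by
    intro t ht
    simp only [mul_pow, Real.sq_sqrt ht.1]
    ring
  rw [norm_sq_funOp_apply hT (hs.fun_mul hf), funOp_congr e, funOp_mul hT hf (hi.fun_mul hf),
    funOp_mul hT hi hf, funOp_id hT, mul_apply_eq_comp, mul_apply_eq_comp,
    inner_funOp_left hT hf (gram A _)]
  generalize funOp f (gram A) v = w
  rw [gram, ContinuousLinearMap.comp_apply, adjoint_inner_left, inner_self_eq_norm_sq]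

theorem norm_apply_eq_funOp_sqrt (v : X) : ‖A v‖ = ‖funOp (fun t => √t) (gram A) v‖ := by
  have h1 := norm_apply_funOp_gram A (f := fun _ => 1) continuousOn_const v
  rw [funOp_const_apply (isPositive_gram A)] at h1
  simpa using h1

theorem norm_apply_funOp_gram_le (hf : ContinuousOn f (Icc 0 ‖gram A‖)) {M : ℝ}
    (hM : ∀ t ∈ Icc 0 ‖gram A‖, √t * |f t| ≤ M) (v : X) :
    ‖A (funOp f (gram A) v)‖ ≤ M * ‖v‖ := by
  rw [norm_apply_funOp_gram A hf]
  refine norm_funOp_apply_le_of_abs_le (isPositive_gram A)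
    (Real.continuous_sqrt.continuousOn.fun_mul hf) (fun t ht => ?_) v
  rw [abs_mul, abs_of_nonneg (Real.sqrt_nonneg t)]
  exact hM t ht

theorem norm_funOp_gram_adjoint_le (hf : ContinuousOn f (Icc 0 ‖gram A‖)) {M : ℝ}
    (hM : ∀ t ∈ Icc 0 ‖gram A‖, √t * |f t| ≤ M) (z : Y) :
    ‖funOp f (gram A) (adjoint A z)‖ ≤ M * ‖z‖ := by
  have hM0 : 0 ≤ M := le_trans (by positivity) (hM 0 ⟨le_rfl, norm_nonneg _⟩)
  have e : funOp f (gram A) ∘L adjoint A = adjoint (A ∘L funOp f (gram A)) := by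
    rw [ContinuousLinearMap.adjoint_comp,
      (ContinuousLinearMap.isSelfAdjoint_iff'.1 (isSelfAdjoint_funOp (isPositive_gram A) hf))]
  have h1 : ‖A ∘L funOp f (gram A)‖ ≤ M :=
    ContinuousLinearMap.opNorm_le_bound _ hM0 (norm_apply_funOp_gram_le A hf hM)
  calc ‖(funOp f (gram A) ∘L adjoint A) z‖ ≤ ‖funOp f (gram A) ∘L adjoint A‖ * ‖z‖ :=
        ContinuousLinearMap.le_opNorm _ z
    _ ≤ M * ‖z‖ := by
        rw [e, LinearIsometryEquiv.norm_map]
        exact mul_le_mul_of_nonneg_right h1 (norm_nonneg z)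

/-- The square root of `f` factors `f(A*A)` symmetrically; this gives the bound on `A f(A*A) A*`. -/
theorem norm_apply_funOp_gram_adjoint_le_sqrt (hf : ContinuousOn f (Icc 0 ‖gram A‖))
    (hf0 : ∀ t ∈ Icc 0 ‖gram A‖, 0 ≤ f t) {M : ℝ} (hM : ∀ t ∈ Icc 0 ‖gram A‖, t * f t ≤ M)
    (v : X) : ‖A (funOp f (gram A) v)‖ ≤ √M * ‖funOp (fun t => √(f t)) (gram A) v‖ := by
  rw [norm_apply_funOp_gram A hf]
  refine norm_funOp_apply_le_mul (isPositive_gram A) (Real.continuous_sqrt.continuousOn.fun_mul hf)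
    hf.sqrt (Real.sqrt_nonneg _) (fun t ht => ?_) v
  rw [abs_of_nonneg (mul_nonneg (Real.sqrt_nonneg t) (hf0 t ht)),
    abs_of_nonneg (Real.sqrt_nonneg _)]
  calc √t * f t = √(t * f t) * √(f t) := by
        rw [Real.sqrt_mul ht.1, mul_assoc, Real.mul_self_sqrt (hf0 t ht)]
    _ ≤ √M * √(f t) := by gcongr; exact hM t ht

theorem norm_apply_funOp_gram_adjoint_le (hf : ContinuousOn f (Icc 0 ‖gram A‖))
    (hf0 : ∀ t ∈ Icc 0 ‖gram A‖, 0 ≤ f t) {M : ℝ} (hM : ∀ t ∈ Icc 0 ‖gram A‖, t * f t ≤ M)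
    (z : Y) : ‖A (funOp f (gram A) (adjoint A z))‖ ≤ M * ‖z‖ := by
  have hM0 : 0 ≤ M := by simpa using hM 0 ⟨le_rfl, norm_nonneg _⟩
  refine (norm_apply_funOp_gram_adjoint_le_sqrt A hf hf0 hM _).trans ?_
  have h1 := norm_funOp_gram_adjoint_le A hf.sqrt (M := √M) (fun t ht => ?_) z
  · calc _ ≤ √M * (√M * ‖z‖) := by gcongr
      _ = M * ‖z‖ := by rw [← mul_assoc, Real.mul_self_sqrt hM0]
  · rw [abs_of_nonneg (Real.sqrt_nonneg _), ← Real.sqrt_mul ht.1]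
    exact Real.sqrt_le_sqrt (hM t ht)

/-- If `0 ≤ f` and `t f(t) ≤ 1`, then `0 ≤ A f(A*A) A* ≤ 1`, so `1 - A f(A*A) A*` is a
contraction. -/
theorem norm_sub_apply_funOp_gram_adjoint_le (hf : ContinuousOn f (Icc 0 ‖gram A‖))
    (hf0 : ∀ t ∈ Icc 0 ‖gram A‖, 0 ≤ f t) (hM : ∀ t ∈ Icc 0 ‖gram A‖, t * f t ≤ 1)
    (z : Y) : ‖z - A (funOp f (gram A) (adjoint A z))‖ ≤ ‖z‖ := by
  have hT := isPositive_gram A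
  have h1 := norm_apply_funOp_gram_adjoint_le_sqrt A hf hf0 hM (adjoint A z)
  rw [Real.sqrt_one, one_mul] at h1
  have h2 : RCLike.re ⟪z, A (funOp f (gram A) (adjoint A z))⟫_𝕜
      = ‖funOp (fun t => √(f t)) (gram A) (adjoint A z)‖ ^ 2 := by
    rw [norm_sq_funOp_apply hT hf.sqrt, ← adjoint_inner_left, ← inner_re_symm,
      funOp_congr (h := f) (fun t ht => Real.sq_sqrt (hf0 t ht))]
  refine le_of_sq_le_sq ?_ (norm_nonneg _)
  rw [norm_sub_sq (𝕜 := 𝕜), h2]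
  nlinarith [norm_nonneg (A (funOp f (gram A) (adjoint A z))),
    sq_nonneg ‖funOp (fun t => √(f t)) (gram A) (adjoint A z)‖]

end Gram

/-! ### Linearization error -/

section MeanValue

variable {𝕜 X Y : Type*} [RCLike 𝕜]
  [NormedAddCommGroup X] [NormedSpace 𝕜 X] [NormedAddCommGroup Y] [NormedSpace 𝕜 Y]

theorem norm_apply_le_add_of_norm_sub_le {A B : X →L[𝕜] Y} {Δ : ℝ} (hΔ : ‖A - B‖ ≤ Δ) (v : X) :
    ‖A v‖ ≤ ‖B v‖ + Δ * ‖v‖ := by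
  have h1 := norm_le_norm_add_norm_sub' (A v) (B v)
  have h2 := (A - B).le_of_opNorm_le hΔ v
  rw [sub_apply] at h2
  linarith

theorem norm_image_sub_sub_le_of_lipschitz_deriv {D : Set X} {F : X → Y} {F' : X → X →L[𝕜] Y}
    {a x : X} {ρ L : ℝ} (hL : 0 ≤ L) (hF : ∀ x ∈ D, HasFDerivWithinAt F (F' x) D x)
    (hD : Metric.ball a ρ ⊆ D)
    (hLip : ∀ x ∈ Metric.ball a ρ, ∀ z ∈ Metric.ball a ρ, ‖F' x - F' z‖ ≤ L * ‖x - z‖)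
    (hx : x ∈ Metric.ball a ρ) :
    ‖F x - F a - F' x (x - a)‖ ≤ L * ‖x - a‖ ^ 2 ∧
      ‖F x - F a - F' a (x - a)‖ ≤ L * ‖x - a‖ ^ 2 := by
  let : NormedSpace ℝ X := .restrictScalars ℝ 𝕜 X
  have ha : a ∈ Metric.ball a ρ := Metric.mem_ball_self ((dist_nonneg).trans_lt hx)
  have hsub : segment ℝ a x ⊆ Metric.ball a ρ := (convex_ball a ρ).segment_subset ha hx
  have hder : ∀ y ∈ segment ℝ a x, HasFDerivWithinAt F (F' y) (segment ℝ a x) y :=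
    fun y hy => (hF y (hD (hsub hy))).mono (hsub.trans hD)
  have key : ∀ b ∈ Metric.ball a ρ, (∀ y ∈ segment ℝ a x, ‖y - b‖ ≤ ‖x - a‖) →
      ‖F x - F a - F' b (x - a)‖ ≤ L * ‖x - a‖ ^ 2 := by
    intro b hb hy
    refine ((convex_segment a x).norm_image_sub_le_of_norm_hasFDerivWithin_le' hder
      (C := L * ‖x - a‖) (fun y hys => ?_) (left_mem_segment ℝ a x)
      (right_mem_segment ℝ a x)).trans_eq (by ring)
    exact (hLip y (hsub hys) b hb).trans (mul_le_mul_of_nonneg_left (hy y hys) hL)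
  refine ⟨key x hx fun y hy => ?_, key a ha fun y hy => ?_⟩
  · rw [norm_sub_rev y x, ← dist_eq_norm, ← dist_eq_norm, dist_comm x y, dist_comm x a]
    linarith [dist_add_dist_of_mem_segment hy, dist_nonneg (x := a) (y := y)]
  · rw [← dist_eq_norm, ← dist_eq_norm, dist_comm y a, dist_comm x a]
    linarith [dist_add_dist_of_mem_segment hy, dist_nonneg (x := y) (y := x)]

end MeanValue

/-! ### Estimates for the regularization operators -/

section Regularization

open Set
open ContinuousLinearMap (adjoint adjoint_inner_left adjoint_inner_right)

variable {𝕜 X Y : Type*} [RCLike 𝕜]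
  [NormedAddCommGroup X] [InnerProductSpace 𝕜 X] [CompleteSpace X]
  [NormedAddCommGroup Y] [InnerProductSpace 𝕜 Y] [CompleteSpace Y]
  {g : ℝ → ℝ → ℝ} {c : Fin 7 → ℝ} {A B : X →L[𝕜] Y} {α β : ℝ}

theorem Icc_norm_gram_subset (hA : ‖A‖ ≤ 1 / √2) : Icc 0 ‖gram A‖ ⊆ Icc (0 : ℝ) (1 / 2) := by
  refine Icc_subset_Icc_right ?_
  rw [norm_gram]
  calc ‖A‖ ^ 2 ≤ (1 / √2) ^ 2 := by gcongr
    _ = 1 / 2 := by rw [div_pow, Real.sq_sqrt (by norm_num)]; norm_num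

theorem GeneratorConditions.continuousOn_gram (hg : GeneratorConditions g c) (hA : ‖A‖ ≤ 1 / √2)
    (hα : 0 < α) : ContinuousOn (g α) (Icc 0 ‖gram A‖) :=
  (hg.continuousOn α hα).mono (Icc_norm_gram_subset hA)

theorem GeneratorConditions.continuousOn_residual (hg : GeneratorConditions g c)
    (hA : ‖A‖ ≤ 1 / √2) (hα : 0 < α) : ContinuousOn (residual g α) (Icc 0 ‖gram A‖) :=
  continuousOn_const.fun_sub (continuousOn_id.fun_mul (hg.continuousOn_gram hA hα))

theorem GeneratorConditions.abs_residual (hg : GeneratorConditions g c) (hA : ‖A‖ ≤ 1 / √2)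
    (hα : 0 < α) {t : ℝ} (ht : t ∈ Icc 0 ‖gram A‖) : |residual g α t| = residual g α t :=
  abs_of_pos (hg.residual_pos α hα t (Icc_norm_gram_subset hA ht))

theorem GeneratorConditions.mul_le_one (hg : GeneratorConditions g c) (hA : ‖A‖ ≤ 1 / √2)
    (hα : 0 < α) {t : ℝ} (ht : t ∈ Icc 0 ‖gram A‖) : t * g α t ≤ 1 := by
  have := hg.residual_pos α hα t (Icc_norm_gram_subset hA ht)
  rw [residual] at this
  linarith

/-- The operator `r_α(A*A)`. -/
noncomputable abbrev residualOp (g : ℝ → ℝ → ℝ) (α : ℝ) (A : X →L[𝕜] Y) : X →L[𝕜] X :=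
  funOp (residual g α) (gram A)

/-- The operator `g_α(A*A)`. -/
noncomputable abbrev generatorOp (g : ℝ → ℝ → ℝ) (α : ℝ) (A : X →L[𝕜] Y) : X →L[𝕜] X :=
  funOp (g α) (gram A)

theorem GeneratorConditions.residualOp_apply (hg : GeneratorConditions g c) (hA : ‖A‖ ≤ 1 / √2)
    (hα : 0 < α) (v : X) : residualOp g α A v = v - generatorOp g α A (adjoint A (A v)) := by
  have hT := isPositive_gram A
  have hc := hg.continuousOn_gram hA hα
  have hi : ContinuousOn (fun t : ℝ => t) (Icc 0 ‖gram A‖) := continuousOn_id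
  have e : EqOn (residual g α) (fun t => 1 - g α t * t) (Icc 0 ‖gram A‖) := fun t _ => by
    rw [residual, mul_comm]
  rw [residualOp, funOp_congr e, funOp_sub hT continuousOn_const (hc.fun_mul hi),
    funOp_mul hT hc hi, funOp_id hT, sub_apply, funOp_const_apply hT, mul_apply_eq_comp,
    RCLike.ofReal_one, one_smul]
  rfl

theorem GeneratorConditions.norm_residualOp_le (hg : GeneratorConditions g c) (hA : ‖A‖ ≤ 1 / √2)
    (hα : 0 < α) (v : X) : ‖residualOp g α A v‖ ≤ ‖v‖ := by
  have := norm_funOp_apply_le_of_abs_le (isPositive_gram A) (hg.continuousOn_residual hA hα)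
    (M := 1) (fun t ht => ?_) v
  · simpa using this
  · rw [hg.abs_residual hA hα ht]
    exact hg.residual_le_one α hα t (Icc_norm_gram_subset hA ht)

theorem GeneratorConditions.sqrt_mul_residual_le (hg : GeneratorConditions g c)
    (hA : ‖A‖ ≤ 1 / √2) (hα : 0 < α) (t : ℝ) (ht : t ∈ Icc 0 ‖gram A‖) :
    √t * |residual g α t| ≤ c 3 * √α := by
  rw [hg.abs_residual hA hα ht, mul_comm]
  exact hg.residual_mul_sqrt_le α hα t (Icc_norm_gram_subset hA ht)

theorem GeneratorConditions.norm_residualOp_adjoint_le (hg : GeneratorConditions g c)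
    (hA : ‖A‖ ≤ 1 / √2) (hα : 0 < α) (z : Y) :
    ‖residualOp g α A (adjoint A z)‖ ≤ c 3 * √α * ‖z‖ :=
  norm_funOp_gram_adjoint_le A (hg.continuousOn_residual hA hα) (hg.sqrt_mul_residual_le hA hα) z

theorem GeneratorConditions.norm_apply_residualOp_le (hg : GeneratorConditions g c)
    (hA : ‖A‖ ≤ 1 / √2) (hα : 0 < α) (v : X) :
    ‖A (residualOp g α A v)‖ ≤ c 3 * √α * ‖v‖ :=
  norm_apply_funOp_gram_le A (hg.continuousOn_residual hA hα) (hg.sqrt_mul_residual_le hA hα) v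

theorem GeneratorConditions.norm_apply_residualOp_le_apply (hg : GeneratorConditions g c)
    (hA : ‖A‖ ≤ 1 / √2) (hα : 0 < α) (v : X) : ‖A (residualOp g α A v)‖ ≤ ‖A v‖ := by
  have hc := hg.continuousOn_residual hA hα
  rw [norm_apply_funOp_gram A hc, norm_apply_eq_funOp_sqrt A v]
  refine norm_funOp_apply_le (isPositive_gram A) (Real.continuous_sqrt.continuousOn.fun_mul hc)
    Real.continuous_sqrt.continuousOn (fun t ht => ?_) v
  rw [abs_mul, hg.abs_residual hA hα ht]
  exact mul_le_of_le_one_right (abs_nonneg _)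
    (hg.residual_le_one α hα t (Icc_norm_gram_subset hA ht))

theorem GeneratorConditions.norm_apply_residualOp_adjoint_le (hg : GeneratorConditions g c)
    (hA : ‖A‖ ≤ 1 / √2) (hα : 0 < α) (z : Y) :
    ‖A (residualOp g α A (adjoint A z))‖ ≤ c 0 * α * ‖z‖ := by
  refine norm_apply_funOp_gram_adjoint_le A (hg.continuousOn_residual hA hα)
    (fun t ht => (hg.residual_pos α hα t (Icc_norm_gram_subset hA ht)).le) (fun t ht => ?_) z
  rw [mul_comm]
  exact hg.residual_mul_le α hα t (Icc_norm_gram_subset hA ht)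

theorem GeneratorConditions.norm_generatorOp_adjoint_le (hg : GeneratorConditions g c)
    (hA : ‖A‖ ≤ 1 / √2) (hα : 0 < α) (z : Y) :
    ‖generatorOp g α A (adjoint A z)‖ ≤ c 4 * (√α)⁻¹ * ‖z‖ := by
  refine norm_funOp_gram_adjoint_le A (hg.continuousOn_gram hA hα) (fun t ht => ?_) z
  rw [abs_of_nonneg (hg.nonneg α hα t (Icc_norm_gram_subset hA ht)), mul_comm]
  exact hg.mul_sqrt_le α hα t (Icc_norm_gram_subset hA ht)

theorem GeneratorConditions.norm_apply_generatorOp_adjoint_le (hg : GeneratorConditions g c)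
    (hA : ‖A‖ ≤ 1 / √2) (hα : 0 < α) (z : Y) :
    ‖A (generatorOp g α A (adjoint A z))‖ ≤ ‖z‖ := by
  simpa using norm_apply_funOp_gram_adjoint_le A (hg.continuousOn_gram hA hα)
    (fun t ht => hg.nonneg α hα t (Icc_norm_gram_subset hA ht)) (M := 1)
    (fun _ ht => hg.mul_le_one hA hα ht) z

theorem GeneratorConditions.norm_sub_apply_generatorOp_adjoint_le (hg : GeneratorConditions g c)
    (hA : ‖A‖ ≤ 1 / √2) (hα : 0 < α) (z : Y) :
    ‖z - A (generatorOp g α A (adjoint A z))‖ ≤ ‖z‖ :=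
  norm_sub_apply_funOp_gram_adjoint_le A (hg.continuousOn_gram hA hα)
    (fun t ht => hg.nonneg α hα t (Icc_norm_gram_subset hA ht))
    (fun _ ht => hg.mul_le_one hA hα ht) z

theorem GeneratorConditions.norm_residualOp_le_mul (hg : GeneratorConditions g c)
    (hA : ‖A‖ ≤ 1 / √2) (hα : 0 < α) (hβ : 0 < β) {a : ℝ} (ha : 0 ≤ a)
    (h : ∀ t ∈ Icc (0 : ℝ) (1 / 2), residual g β t ≤ a * residual g α t) (v : X) :
    ‖residualOp g β A v‖ ≤ a * ‖residualOp g α A v‖ := by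
  refine norm_funOp_apply_le_mul (isPositive_gram A) (hg.continuousOn_residual hA hβ)
    (hg.continuousOn_residual hA hα) ha (fun t ht => ?_) v
  rw [hg.abs_residual hA hα ht, hg.abs_residual hA hβ ht]
  exact h t (Icc_norm_gram_subset hA ht)

/-- Passing from `r_β` to `r_α` with a smaller parameter costs `α^(-1/2)` times the image of the
residual under `A`. -/
theorem GeneratorConditions.norm_residualOp_le_add (hg : GeneratorConditions g c)
    (hc : 0 ≤ c 2) (hA : ‖A‖ ≤ 1 / √2) (hα : 0 < α) (hαβ : α ≤ β) (v : X) :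
    ‖residualOp g β A v‖
      ≤ ‖residualOp g α A v‖ + c 2 * (√α)⁻¹ * ‖A (residualOp g β A v)‖ := by
  have hβ := hα.trans_le hαβ
  have h1 := hg.continuousOn_residual hA hα
  have h2 := hg.continuousOn_residual hA hβ
  have h3 : ‖funOp (fun t => residual g β t - residual g α t) (gram A) v‖
      ≤ c 2 * (√α)⁻¹ * ‖A (residualOp g β A v)‖ := by
    rw [norm_apply_funOp_gram A h2]
    refine norm_funOp_apply_le_mul (isPositive_gram A) (h2.fun_sub h1)
      (Real.continuous_sqrt.continuousOn.fun_mul h2) (by positivity) (fun t ht => ?_) v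
    have ht' := Icc_norm_gram_subset hA ht
    rw [abs_of_nonneg (sub_nonneg.2 (hg.residual_mono α β hα hαβ t ht')), abs_mul,
      hg.abs_residual hA hβ ht, abs_of_nonneg (Real.sqrt_nonneg t)]
    have := hg.residual_sub_le α β hα hαβ t ht'
    rw [Real.sqrt_div ht.1] at this
    calc _ ≤ _ := this
      _ = _ := by ring
  rw [funOp_sub (isPositive_gram A) h2 h1, sub_apply] at h3
  have := norm_le_norm_add_norm_sub' (residualOp g β A v) (residualOp g α A v)
  linarith

theorem GeneratorConditions.norm_le_residualOp_add (hg : GeneratorConditions g c)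
    (hA : ‖A‖ ≤ 1 / √2) (hα : 0 < α) (v : X) :
    ‖v‖ ≤ ‖residualOp g α A v‖ + c 4 * (√α)⁻¹ * ‖A v‖ := by
  have h1 := hg.norm_generatorOp_adjoint_le hA hα (A v)
  have h2 := norm_le_norm_add_norm_sub' v (residualOp g α A v)
  rw [hg.residualOp_apply hA hα v, sub_sub_cancel] at h2
  rw [hg.residualOp_apply hA hα v]
  linarith

/-- If `r_α ≥ a⁻¹` on the spectrum of `A*A`, then `r_α(A*A)` is bounded below, and so is its
composition with `A`. -/
theorem GeneratorConditions.norm_le_mul_residualOp (hg : GeneratorConditions g c)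
    (hA : ‖A‖ ≤ 1 / √2) (hα : 0 < α) {a : ℝ} (ha : 0 ≤ a)
    (h : ∀ t ∈ Icc 0 ‖gram A‖, 1 ≤ a * residual g α t) (v : X) :
    ‖v‖ ≤ a * ‖residualOp g α A v‖ ∧ ‖A v‖ ≤ a * ‖A (residualOp g α A v)‖ := by
  have hT := isPositive_gram A
  have hr := hg.continuousOn_residual hA hα
  have hs : ContinuousOn (fun t : ℝ => √t) (Icc 0 ‖gram A‖) := Real.continuous_sqrt.continuousOn
  constructor
  · have := norm_funOp_apply_le_mul hT (f := fun _ => 1) continuousOn_const hr ha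
      (fun t ht => by rw [hg.abs_residual hA hα ht, abs_one]; exact h t ht) v
    rwa [funOp_const_apply hT, RCLike.ofReal_one, one_smul] at this
  · rw [norm_apply_funOp_gram A hr, norm_apply_eq_funOp_sqrt A v]
    refine norm_funOp_apply_le_mul hT hs (hs.fun_mul hr) ha (fun t ht => ?_) v
    rw [abs_mul, hg.abs_residual hA hα ht]
    nlinarith [h t ht, abs_nonneg √t]

/-! ### Source conditions -/

section SourceCondition

variable {ν d : ℝ} {ω : X}

theorem continuousOn_rpow_of_nonneg {s : Set ℝ} (hν : 0 ≤ ν) :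
    ContinuousOn (fun t : ℝ => t ^ ν) s :=
  (Real.continuous_rpow_const hν).continuousOn

/-- The bound of order `ν + 1/2` implies the bound of order `ν`: use it for `t ≥ α`, and `r ≤ 1`
for `t < α`. -/
theorem GeneratorConditions.residual_mul_rpow_le (hg : GeneratorConditions g c)
    (hν : 0 ≤ ν) (hd : RateBound g (ν + 1 / 2) d) (hd0 : 0 ≤ d) (hα : 0 < α) {t : ℝ}
    (ht : t ∈ Icc (0 : ℝ) (1 / 2)) : residual g α t * t ^ ν ≤ (d + 1) * α ^ ν := by
  have hr0 := hg.residual_pos α hα t ht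
  have hr1 := hg.residual_le_one α hα t ht
  have hαν : 0 ≤ α ^ ν := by positivity
  rcases le_total t α with h | h
  · have h1 : t ^ ν ≤ α ^ ν := Real.rpow_le_rpow ht.1 h hν
    have h2 : 0 ≤ t ^ ν := Real.rpow_nonneg ht.1 _
    nlinarith
  · have h1 := hd α hα t ht
    have htp : 0 < t := hα.trans_le h
    rw [Real.rpow_add htp, Real.rpow_add hα, ← Real.sqrt_eq_rpow, ← Real.sqrt_eq_rpow] at h1
    have h2 : √α ≤ √t := Real.sqrt_le_sqrt h
    have h3 : 0 < √α := Real.sqrt_pos.2 hα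
    have h4 : residual g α t * t ^ ν * √α ≤ d * α ^ ν * √α := by
      calc residual g α t * t ^ ν * √α ≤ residual g α t * t ^ ν * √t := by
            gcongr
        _ ≤ d * α ^ ν * √α := by linarith
    have := le_of_mul_le_mul_right h4 h3
    linarith

theorem GeneratorConditions.norm_residualOp_rpow_le (hg : GeneratorConditions g c)
    (hν : 0 ≤ ν) (hd : RateBound g (ν + 1 / 2) d) (hd0 : 0 ≤ d) (hA : ‖A‖ ≤ 1 / √2) (hα : 0 < α)
    (ω : X) :
    ‖residualOp g α A (funOp (fun t : ℝ => t ^ ν) (gram A) ω)‖ ≤ (d + 1) * α ^ ν * ‖ω‖ := by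
  have hr := hg.continuousOn_residual hA hα
  have hp := continuousOn_rpow_of_nonneg (s := Icc 0 ‖gram A‖) hν
  rw [residualOp, ← mul_apply_eq_comp, ← funOp_mul (isPositive_gram A) hr hp]
  refine norm_funOp_apply_le_of_abs_le (isPositive_gram A) (hr.fun_mul hp) (fun t ht => ?_) ω
  rw [abs_mul, hg.abs_residual hA hα ht, abs_of_nonneg (Real.rpow_nonneg ht.1 _)]
  exact hg.residual_mul_rpow_le hν hd hd0 hα (Icc_norm_gram_subset hA ht)

theorem GeneratorConditions.norm_apply_residualOp_rpow_le (hg : GeneratorConditions g c)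
    (hν : 0 ≤ ν) (hd : RateBound g (ν + 1 / 2) d) (hA : ‖A‖ ≤ 1 / √2) (hα : 0 < α)
    (ω : X) :
    ‖A (residualOp g α A (funOp (fun t : ℝ => t ^ ν) (gram A) ω))‖
      ≤ d * α ^ (ν + 1 / 2) * ‖ω‖ := by
  have hr := hg.continuousOn_residual hA hα
  have hp := continuousOn_rpow_of_nonneg (s := Icc 0 ‖gram A‖) hν
  rw [residualOp, ← mul_apply_eq_comp, ← funOp_mul (isPositive_gram A) hr hp]
  refine norm_apply_funOp_gram_le A (hr.fun_mul hp) (fun t ht => ?_) ω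
  rw [abs_mul, hg.abs_residual hA hα ht, abs_of_nonneg (Real.rpow_nonneg ht.1 _)]
  refine le_of_eq_of_le ?_ (hd α hα t (Icc_norm_gram_subset hA ht))
  rw [Real.rpow_add' ht.1 (by positivity), ← Real.sqrt_eq_rpow]
  ring

/-- The range of `(A*A)^ν` with `ν ≥ 1/2` lies in the range of `A*`: the functional
`A v ↦ ⟪(A*A)^ν ω, v⟫` on the range of `A` is bounded because `‖(A*A)^(1/2) v‖ = ‖A v‖`, so it
extends to `Y` and is represented by a vector there. The representing vector is made unique by
projecting away its component in the kernel of `A*`. -/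
theorem exists_adjoint_eq_rpow (A : X →L[𝕜] Y) (hν : 1 / 2 ≤ ν) (ω : X) :
    ∃ u ∈ (LinearMap.ker (adjoint A : Y →ₗ[𝕜] X))ᗮ,
      funOp (fun t : ℝ => t ^ ν) (gram A) ω = adjoint A u := by
  have hT := isPositive_gram A
  set e := funOp (fun t : ℝ => t ^ ν) (gram A) ω with he
  have hs : ContinuousOn (fun t : ℝ => √t) (Icc 0 ‖gram A‖) := Real.continuous_sqrt.continuousOn
  have hp := continuousOn_rpow_of_nonneg (s := Icc 0 ‖gram A‖) (ν := ν - 1 / 2) (by linarith)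
  set w := funOp (fun t : ℝ => t ^ (ν - 1 / 2)) (gram A) ω with hw
  have hew : e = funOp (fun t => √t) (gram A) w := by
    rw [he, hw, ← mul_apply_eq_comp, ← funOp_mul hT hs hp]
    congr 1
    refine funOp_congr fun t ht => ?_
    simp only [Real.sqrt_eq_rpow]
    rw [← Real.rpow_add' ht.1 (by linarith)]
    congr 1; ring
  have hbd : ∀ v, ‖⟪e, v⟫_𝕜‖ ≤ ‖w‖ * ‖A v‖ := fun v => by
    rw [hew, inner_funOp_left hT hs, norm_apply_eq_funOp_sqrt A v]
    exact norm_inner_le_norm _ _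
  obtain ⟨s, hs'⟩ := (A : X →ₗ[𝕜] Y).rangeRestrict.exists_rightInverse_of_surjective
    (A : X →ₗ[𝕜] Y).range_rangeRestrict
  have hAs : ∀ y, A (s y) = y := fun y => congrArg Subtype.val (LinearMap.congr_fun hs' y)
  let φ : StrongDual 𝕜 (LinearMap.range (A : X →ₗ[𝕜] Y)) :=
    LinearMap.mkContinuous ((innerSL 𝕜 e : X →ₗ[𝕜] 𝕜) ∘ₗ s) ‖w‖ fun y => by
      have := hbd (s y)
      rw [hAs] at this
      simpa using this
  obtain ⟨ψ, hψ, -⟩ := exists_extension_norm_eq _ φ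
  set u₀ := (InnerProductSpace.toDual 𝕜 Y).symm ψ with hu₀
  have hu : e = adjoint A u₀ := by
    refine ext_inner_right 𝕜 fun v => ?_
    rw [adjoint_inner_left, hu₀, InnerProductSpace.toDual_symm_apply]
    have h1 := hψ ⟨A v, v, rfl⟩
    have h2 : φ ⟨A v, v, rfl⟩ = ⟪e, s ⟨A v, v, rfl⟩⟫_𝕜 := rfl
    have h3 := hbd (v - s ⟨A v, v, rfl⟩)
    rw [map_sub, hAs, sub_self, norm_zero, mul_zero, norm_le_zero_iff, inner_sub_right,
      sub_eq_zero] at h3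
    rw [h3, ← h2]
    exact h1.symm
  have : CompleteSpace (LinearMap.ker (adjoint A : Y →ₗ[𝕜] X)) :=
    (adjoint A).isClosed_ker.completeSpace_coe
  set K := LinearMap.ker (adjoint A : Y →ₗ[𝕜] X) with hK
  refine ⟨u₀ - K.starProjection u₀, K.sub_starProjection_mem_orthogonal u₀, ?_⟩
  have h4 : adjoint A (K.starProjection u₀) = 0 := K.starProjection_apply_mem u₀
  rw [map_sub, h4, sub_zero, hu]

theorem eq_of_adjoint_eq {u v : Y} (hu : u ∈ (LinearMap.ker (adjoint A : Y →ₗ[𝕜] X))ᗮ)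
    (hv : v ∈ (LinearMap.ker (adjoint A : Y →ₗ[𝕜] X))ᗮ) (h : adjoint A v = adjoint A u) :
    v = u := by
  have h1 : v - u ∈ LinearMap.ker (adjoint A : Y →ₗ[𝕜] X) := by
    simp [LinearMap.mem_ker, h]
  have h2 := Submodule.inner_right_of_mem_orthogonal h1 (Submodule.sub_mem _ hv hu)
  exact sub_eq_zero.1 (inner_self_eq_zero.1 h2)

end SourceCondition

section OneStep

/-! ### Perturbation of the operator -/

variable {u z z' s : Y} {e₀ : X} {Δ : ℝ}

theorem norm_adjoint_sub_apply_le (hΔ : ‖A - B‖ ≤ Δ) (y : Y) :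
    ‖adjoint A y - adjoint B y‖ ≤ Δ * ‖y‖ := by
  have h1 : ‖adjoint (A - B)‖ ≤ Δ := by rwa [LinearIsometryEquiv.norm_map]
  have h2 := (adjoint (A - B)).le_of_opNorm_le h1 y
  rwa [map_sub, sub_apply] at h2

theorem GeneratorConditions.norm_residualOp_adjoint_le_of_near (hg : GeneratorConditions g c)
    (hB : ‖B‖ ≤ 1 / √2) (hα : 0 < α) (hΔ : ‖A - B‖ ≤ Δ) (u : Y) :
    ‖residualOp g α B (adjoint A u)‖ ≤ (c 3 * √α + Δ) * ‖u‖ := by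
  have h1 := hg.norm_residualOp_adjoint_le hB hα u
  have h2 := (hg.norm_residualOp_le hB hα (adjoint A u - adjoint B u)).trans
    (norm_adjoint_sub_apply_le hΔ u)
  rw [map_sub] at h2
  have h3 := norm_le_norm_add_norm_sub' (residualOp g α B (adjoint A u))
    (residualOp g α B (adjoint B u))
  linarith

theorem GeneratorConditions.norm_apply_residualOp_adjoint_le_of_near
    (hg : GeneratorConditions g c) (hc3 : 0 ≤ c 3)
    (hB : ‖B‖ ≤ 1 / √2) (hα : 0 < α) (hΔ : ‖A - B‖ ≤ Δ) (u : Y) :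
    ‖A (residualOp g α B (adjoint A u))‖ ≤ (c 0 * α + 2 * c 3 * √α * Δ + Δ ^ 2) * ‖u‖ := by
  have hΔ0 : 0 ≤ Δ := (norm_nonneg _).trans hΔ
  have h1 := hg.norm_apply_residualOp_adjoint_le hB hα u
  have h2 := hg.norm_apply_residualOp_le hB hα (adjoint A u - adjoint B u)
  have h3 := norm_adjoint_sub_apply_le hΔ u
  have h4 := norm_apply_le_add_of_norm_sub_le hΔ (residualOp g α B (adjoint A u))
  have h5 := hg.norm_residualOp_adjoint_le_of_near hB hα hΔ u
  have h6 := norm_le_norm_add_norm_sub' (B (residualOp g α B (adjoint A u)))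
    (B (residualOp g α B (adjoint B u)))
  rw [map_sub, map_sub] at h2
  have h7 : c 3 * √α * ‖adjoint A u - adjoint B u‖ ≤ c 3 * √α * (Δ * ‖u‖) := by gcongr
  have h8 := mul_le_mul_of_nonneg_left h5 hΔ0
  linarith

/-- The residual after one step, `A e' + s` with `e' = r(B*B) e₀ - g(B*B) B* (s + z')`. The noise
`s` enters through the contraction `1 - B g(B*B) B*`, so its coefficient is close to one. -/
theorem GeneratorConditions.norm_apply_step_add_le (hg : GeneratorConditions g c)
    (hB : ‖B‖ ≤ 1 / √2) (hα : 0 < α) (hΔ : ‖A - B‖ ≤ Δ) (e₀ : X) (s z' : Y) :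
    ‖A (residualOp g α B e₀ - generatorOp g α B (adjoint B (s + z'))) + s‖
      ≤ ‖A (residualOp g α B e₀)‖ + (1 + c 4 * (√α)⁻¹ * Δ) * (‖s‖ + ‖z'‖) := by
  have hΔ0 : 0 ≤ Δ := (norm_nonneg _).trans hΔ
  set G := generatorOp g α B (adjoint B (s + z')) with hG
  have h1 : ‖s - B G‖ ≤ ‖s‖ + ‖z'‖ := by
    have h := hg.norm_sub_apply_generatorOp_adjoint_le hB hα s
    have h' := hg.norm_apply_generatorOp_adjoint_le hB hα z'
    have e : s - B G = (s - B (generatorOp g α B (adjoint B s)))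
        - B (generatorOp g α B (adjoint B z')) := by
      rw [hG]; simp only [map_add]; abel
    rw [e]
    exact (norm_sub_le _ _).trans (add_le_add h h')
  have h2 : ‖(A - B) G‖ ≤ Δ * (c 4 * (√α)⁻¹ * ‖s + z'‖) :=
    ((A - B).le_of_opNorm_le hΔ _).trans
      (mul_le_mul_of_nonneg_left (hg.norm_generatorOp_adjoint_le hB hα _) hΔ0)
  have h3 : Δ * (c 4 * (√α)⁻¹ * ‖s + z'‖) ≤ Δ * (c 4 * (√α)⁻¹ * (‖s‖ + ‖z'‖)) := by
    have : 0 ≤ c 4 * (√α)⁻¹ := by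
      have := hg.mul_sqrt_le α hα 0 (by norm_num)
      simpa using this
    gcongr
    exact norm_add_le _ _
  have e : A (residualOp g α B e₀ - G) + s
      = A (residualOp g α B e₀) + (s - B G) - (A - B) G := by
    simp only [map_sub, sub_apply]; abel
  rw [e]
  have h4 := norm_sub_le (A (residualOp g α B e₀) + (s - B G)) ((A - B) G)
  have h5 := norm_add_le (A (residualOp g α B e₀)) (s - B G)
  linarith

theorem CommutatorEstimates.norm_residualOp_adjoint_sub_le {c6 : ℝ}
    (hC : CommutatorEstimates 𝕜 X Y g c6) (hc6 : 0 ≤ c6) (hA : ‖A‖ ≤ 1 / √2) (hB : ‖B‖ ≤ 1 / √2)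
    (hα : 0 < α) (hΔ : ‖A - B‖ ≤ Δ) (u : Y) :
    ‖residualOp g α B (adjoint A u) - residualOp g α A (adjoint A u)‖ ≤ c6 * Δ * ‖u‖ := by
  have h1 := hC.residual_sub_comp α hα B A hB hA
  rw [norm_sub_rev B A] at h1
  have h2 := ContinuousLinearMap.le_of_opNorm_le _
    (h1.trans (mul_le_mul_of_nonneg_left hΔ hc6)) u
  simpa using h2

theorem CommutatorEstimates.norm_apply_residualOp_adjoint_sub_le {c6 : ℝ}
    (hC : CommutatorEstimates 𝕜 X Y g c6) (hc6 : 0 ≤ c6) (hA : ‖A‖ ≤ 1 / √2) (hB : ‖B‖ ≤ 1 / √2)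
    (hα : 0 < α) (hΔ : ‖A - B‖ ≤ Δ) (u : Y) :
    ‖A (residualOp g α B (adjoint A u) - residualOp g α A (adjoint A u))‖
      ≤ c6 * (√α + Δ) * Δ * ‖u‖ := by
  have hΔ0 : 0 ≤ Δ := (norm_nonneg _).trans hΔ
  have h1 := hC.comp_residual_sub_comp α hα B A hB hA
  rw [norm_sub_rev B A] at h1
  have h2 := ContinuousLinearMap.le_of_opNorm_le _
    (h1.trans (mul_le_mul_of_nonneg_left hΔ (by positivity))) u
  have h3 := hC.norm_residualOp_adjoint_sub_le hc6 hA hB hα hΔ u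
  have h4 := norm_apply_le_add_of_norm_sub_le hΔ
    (residualOp g α B (adjoint A u) - residualOp g α A (adjoint A u))
  have h5 := mul_le_mul_of_nonneg_left h3 hΔ0
  simp only [ContinuousLinearMap.comp_apply, sub_apply] at h2
  linarith

/-- `‖r(B*B) A*u‖² = ⟪A r(B*B)² A*u, u⟫` is controlled by the image of `r(B*B) A*u` under `B`. -/
theorem GeneratorConditions.norm_residualOp_adjoint_sq_le (hg : GeneratorConditions g c)
    (hB : ‖B‖ ≤ 1 / √2) (hα : 0 < α) (hΔ : ‖A - B‖ ≤ Δ) (u : Y) :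
    ‖residualOp g α B (adjoint A u)‖ ^ 2 ≤ ‖u‖ *
      (‖B (residualOp g α B (adjoint A u))‖ + Δ * ‖residualOp g α B (adjoint A u)‖) := by
  have hΔ0 : 0 ≤ Δ := (norm_nonneg _).trans hΔ
  set p := residualOp g α B (adjoint A u) with hp
  have h1 : ‖p‖ ^ 2 = RCLike.re ⟪u, A (residualOp g α B p)⟫_𝕜 := by
    rw [← adjoint_inner_left, ← inner_funOp_left (isPositive_gram B)
      (hg.continuousOn_residual hB hα), ← inner_self_eq_norm_sq (𝕜 := 𝕜), hp]
  have h2 : RCLike.re ⟪u, A (residualOp g α B p)⟫_𝕜 ≤ ‖u‖ * ‖A (residualOp g α B p)‖ :=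
    (RCLike.re_le_norm _).trans (norm_inner_le_norm _ _)
  have h3 := norm_apply_le_add_of_norm_sub_le hΔ (residualOp g α B p)
  have h4 := hg.norm_apply_residualOp_le_apply hB hα p
  have h5 := mul_le_mul_of_nonneg_left (hg.norm_residualOp_le hB hα p) hΔ0
  rw [h1]
  refine h2.trans (mul_le_mul_of_nonneg_left ?_ (norm_nonneg u))
  linarith

end OneStep

end Regularization

/-! ### Error and residual of one Newton step -/

section NewtonStep

open Set
open ContinuousLinearMap (adjoint)

variable {𝕜 X Y : Type*} [RCLike 𝕜]
  [NormedAddCommGroup X] [InnerProductSpace 𝕜 X] [CompleteSpace X]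
  [NormedAddCommGroup Y] [InnerProductSpace 𝕜 Y] [CompleteSpace Y]
  {g : ℝ → ℝ → ℝ} {c : Fin 7 → ℝ} {F : X → Y} {F' : X → X →L[𝕜] Y}
  {xdag x₀ x : X} {ρ L δ α : ℝ} {u y : Y}

/-- The assumptions that enter the analysis of a single Newton step: the conditions on the
generator, the commutator estimates, a Lipschitz derivative with nonnegative constant `L` in the
ball `B_ρ(xdag)` together with the remainder bounds which it implies, the source representation
`x₀ - xdag = F'(xdag)* u`, and noisy data `y` within `δ` of `F xdag`. -/
structure NewtonSetting (g : ℝ → ℝ → ℝ) (c : Fin 7 → ℝ) (F : X → Y) (F' : X → X →L[𝕜] Y)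
    (xdag x₀ : X) (ρ L δ : ℝ) (u y : Y) : Prop where
  c_pos : ∀ i, 0 < c i
  gen : GeneratorConditions g c
  comm : CommutatorEstimates 𝕜 X Y g (c 6)
  rho_pos : 0 < ρ
  L_nonneg : 0 ≤ L
  norm_deriv_le : ∀ x ∈ Metric.ball xdag ρ, ‖F' x‖ ≤ 1 / √2
  lipschitz : ∀ x ∈ Metric.ball xdag ρ, ∀ z ∈ Metric.ball xdag ρ, ‖F' x - F' z‖ ≤ L * ‖x - z‖
  remainder : ∀ x ∈ Metric.ball xdag ρ, ‖F x - F xdag - F' x (x - xdag)‖ ≤ L * ‖x - xdag‖ ^ 2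
  remainder' : ∀ x ∈ Metric.ball xdag ρ,
    ‖F x - F xdag - F' xdag (x - xdag)‖ ≤ L * ‖x - xdag‖ ^ 2
  source : x₀ - xdag = adjoint (F' xdag) u
  noise : ‖y - F xdag‖ ≤ δ

variable (g F F' x₀ y) in
/-- The Newton update of `x` with regularization parameter `α`. -/
noncomputable def newtonStep (α : ℝ) (x : X) : X :=
  x₀ - funOp (g α) (gram (F' x)) (adjoint (F' x) (F x - y - F' x (x - x₀)))

theorem newtonIter_succ (a : ℕ → ℝ) (k : ℕ) :
    newtonIter g a F F' x₀ y (k + 1)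
      = newtonStep g F F' x₀ y (a k) (newtonIter g a F F' x₀ y k) := rfl

namespace NewtonSetting

variable (S : NewtonSetting g c F F' xdag x₀ ρ L δ u y)
include S

theorem xdag_mem : xdag ∈ Metric.ball xdag ρ := Metric.mem_ball_self S.rho_pos

theorem norm_deriv_xdag_le : ‖F' xdag‖ ≤ 1 / √2 := S.norm_deriv_le _ S.xdag_mem

theorem noise' : ‖F xdag - y‖ ≤ δ := by rw [norm_sub_rev]; exact S.noise

theorem norm_deriv_sub_le (hx : x ∈ Metric.ball xdag ρ) :
    ‖F' xdag - F' x‖ ≤ L * ‖x - xdag‖ := by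
  rw [norm_sub_rev x]; exact S.lipschitz _ S.xdag_mem x hx

/-- The error after one step: the filtered initial error minus the propagated noise and
linearization error. -/
theorem newtonStep_sub (hx : x ∈ Metric.ball xdag ρ) (hα : 0 < α) :
    newtonStep g F F' x₀ y α x - xdag = residualOp g α (F' x) (x₀ - xdag)
      - generatorOp g α (F' x) (adjoint (F' x)
        ((F xdag - y) + (F x - F xdag - F' x (x - xdag)))) := by
  rw [S.gen.residualOp_apply (S.norm_deriv_le x hx) hα, newtonStep]
  have e : F x - y - F' x (x - x₀) = F' x (x₀ - xdag)
      + ((F xdag - y) + (F x - F xdag - F' x (x - xdag))) := by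
    simp only [map_sub]; abel
  rw [e, map_add, map_add]
  abel

theorem norm_propagated_le (hx : x ∈ Metric.ball xdag ρ) (hα : 0 < α) :
    ‖generatorOp g α (F' x) (adjoint (F' x)
        ((F xdag - y) + (F x - F xdag - F' x (x - xdag))))‖
      ≤ c 4 * (√α)⁻¹ * (δ + L * ‖x - xdag‖ ^ 2) := by
  refine (S.gen.norm_generatorOp_adjoint_le (S.norm_deriv_le x hx) hα _).trans ?_
  have := S.c_pos 4
  gcongr
  exact (norm_add_le _ _).trans (add_le_add S.noise' (S.remainder x hx))

theorem norm_newtonStep_sub_le (hx : x ∈ Metric.ball xdag ρ) (hα : 0 < α) :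
    ‖newtonStep g F F' x₀ y α x - xdag‖ ≤ ‖residualOp g α (F' x) (x₀ - xdag)‖
      + c 4 * (√α)⁻¹ * (δ + L * ‖x - xdag‖ ^ 2) := by
  rw [S.newtonStep_sub hx hα]
  exact (norm_sub_le _ _).trans (add_le_add le_rfl (S.norm_propagated_le hx hα))

theorem norm_newtonStep_sub_le_source (hx : x ∈ Metric.ball xdag ρ) (hα : 0 < α) :
    ‖newtonStep g F F' x₀ y α x - xdag‖ ≤ (c 3 * √α + L * ‖x - xdag‖) * ‖u‖
      + c 4 * (√α)⁻¹ * (δ + L * ‖x - xdag‖ ^ 2) := by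
  have h1 := S.gen.norm_residualOp_adjoint_le_of_near (S.norm_deriv_le x hx) hα
    (S.norm_deriv_sub_le hx) u
  rw [← S.source] at h1
  linarith [S.norm_newtonStep_sub_le hx hα]

theorem norm_newtonStep_sub_le_initial (hx : x ∈ Metric.ball xdag ρ) (hα : 0 < α) :
    ‖newtonStep g F F' x₀ y α x - xdag‖ ≤ ‖x₀ - xdag‖
      + c 4 * (√α)⁻¹ * (δ + L * ‖x - xdag‖ ^ 2) := by
  have h1 := S.gen.norm_residualOp_le (S.norm_deriv_le x hx) hα (x₀ - xdag)
  linarith [S.norm_newtonStep_sub_le hx hα]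

theorem norm_residualOp_sub_residualOp_le (hx : x ∈ Metric.ball xdag ρ) (hα : 0 < α) :
    ‖residualOp g α (F' x) (x₀ - xdag) - residualOp g α (F' xdag) (x₀ - xdag)‖
      ≤ c 6 * (L * ‖x - xdag‖) * ‖u‖ := by
  rw [S.source]
  exact S.comm.norm_residualOp_adjoint_sub_le (S.c_pos 6).le S.norm_deriv_xdag_le
    (S.norm_deriv_le x hx) hα (S.norm_deriv_sub_le hx) u

theorem norm_newtonStep_sub_le_residual (hx : x ∈ Metric.ball xdag ρ) (hα : 0 < α) :
    ‖newtonStep g F F' x₀ y α x - xdag‖ ≤ ‖residualOp g α (F' xdag) (x₀ - xdag)‖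
      + c 6 * (L * ‖x - xdag‖) * ‖u‖ + c 4 * (√α)⁻¹ * (δ + L * ‖x - xdag‖ ^ 2) := by
  have h1 := S.norm_residualOp_sub_residualOp_le hx hα
  have h2 := norm_le_norm_add_norm_sub' (residualOp g α (F' x) (x₀ - xdag))
    (residualOp g α (F' xdag) (x₀ - xdag))
  linarith [S.norm_newtonStep_sub_le hx hα]

theorem norm_image_newtonStep_sub_le (hx : x ∈ Metric.ball xdag ρ) (hα : 0 < α)
    (hx' : newtonStep g F F' x₀ y α x ∈ Metric.ball xdag ρ) :
    ‖F (newtonStep g F F' x₀ y α x) - y‖ ≤ L * ‖newtonStep g F F' x₀ y α x - xdag‖ ^ 2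
      + ‖F' xdag (residualOp g α (F' x) (x₀ - xdag))‖
      + (1 + c 4 * (√α)⁻¹ * (L * ‖x - xdag‖)) * (δ + L * ‖x - xdag‖ ^ 2) := by
  have h1 := S.gen.norm_apply_step_add_le (S.norm_deriv_le x hx) hα (S.norm_deriv_sub_le hx)
    (x₀ - xdag) (F xdag - y) (F x - F xdag - F' x (x - xdag))
  rw [← S.newtonStep_sub hx hα] at h1
  have h2 := S.remainder' _ hx'
  set x' := newtonStep g F F' x₀ y α x
  have h3 : ‖F x' - y‖ ≤ ‖F x' - F xdag - F' xdag (x' - xdag)‖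
      + ‖F' xdag (x' - xdag) + (F xdag - y)‖ := by
    refine le_of_eq_of_le (congrArg _ ?_) (norm_add_le _ _)
    abel
  have h4 : (1 + c 4 * (√α)⁻¹ * (L * ‖x - xdag‖))
        * (‖F xdag - y‖ + ‖F x - F xdag - F' x (x - xdag)‖)
      ≤ (1 + c 4 * (√α)⁻¹ * (L * ‖x - xdag‖)) * (δ + L * ‖x - xdag‖ ^ 2) := by
    have := S.c_pos 4
    have := S.L_nonneg
    gcongr
    · exact S.noise'
    · exact S.remainder x hx
  linarith

theorem norm_image_newtonStep_sub_le_source (hx : x ∈ Metric.ball xdag ρ) (hα : 0 < α)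
    (hx' : newtonStep g F F' x₀ y α x ∈ Metric.ball xdag ρ) :
    ‖F (newtonStep g F F' x₀ y α x) - y‖ ≤ L * ‖newtonStep g F F' x₀ y α x - xdag‖ ^ 2
      + (c 0 * α + 2 * c 3 * √α * (L * ‖x - xdag‖) + (L * ‖x - xdag‖) ^ 2) * ‖u‖
      + (1 + c 4 * (√α)⁻¹ * (L * ‖x - xdag‖)) * (δ + L * ‖x - xdag‖ ^ 2) := by
  have h1 := S.gen.norm_apply_residualOp_adjoint_le_of_near (S.c_pos 3).le (S.norm_deriv_le x hx)
    hα (S.norm_deriv_sub_le hx) u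
  rw [← S.source] at h1
  linarith [S.norm_image_newtonStep_sub_le hx hα hx']

theorem norm_image_newtonStep_sub_le_residual (hx : x ∈ Metric.ball xdag ρ) (hα : 0 < α)
    (hx' : newtonStep g F F' x₀ y α x ∈ Metric.ball xdag ρ) :
    ‖F (newtonStep g F F' x₀ y α x) - y‖ ≤ L * ‖newtonStep g F F' x₀ y α x - xdag‖ ^ 2
      + ‖F' xdag (residualOp g α (F' xdag) (x₀ - xdag))‖
      + c 6 * (√α + L * ‖x - xdag‖) * (L * ‖x - xdag‖) * ‖u‖
      + (1 + c 4 * (√α)⁻¹ * (L * ‖x - xdag‖)) * (δ + L * ‖x - xdag‖ ^ 2) := by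
  have h1 := S.comm.norm_apply_residualOp_adjoint_sub_le (S.c_pos 6).le S.norm_deriv_xdag_le
    (S.norm_deriv_le x hx) hα (S.norm_deriv_sub_le hx) u
  rw [← S.source, map_sub] at h1
  have h2 := norm_le_norm_add_norm_sub' (F' xdag (residualOp g α (F' x) (x₀ - xdag)))
    (F' xdag (residualOp g α (F' xdag) (x₀ - xdag)))
  linarith [S.norm_image_newtonStep_sub_le hx hα hx']

theorem norm_deriv_apply_sub_le (hx : x ∈ Metric.ball xdag ρ) :
    ‖F' xdag (x - xdag)‖ ≤ ‖F x - y‖ + δ + L * ‖x - xdag‖ ^ 2 := by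
  have h1 := S.remainder' x hx
  have h2 : ‖F' xdag (x - xdag)‖
      ≤ ‖F x - y‖ + ‖y - F xdag‖ + ‖F x - F xdag - F' xdag (x - xdag)‖ := by
    refine le_of_eq_of_le (congrArg _ ?_)
      ((norm_sub_le _ _).trans (add_le_add (norm_add_le _ _) le_rfl))
    abel
  linarith [S.noise]

/-- The image under `F'(x)` of the filtered initial error is controlled by the residual of the
updated iterate. -/
theorem norm_deriv_apply_residualOp_le (hx : x ∈ Metric.ball xdag ρ) (hα : 0 < α)
    (hx' : newtonStep g F F' x₀ y α x ∈ Metric.ball xdag ρ) :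
    ‖F' x (residualOp g α (F' x) (x₀ - xdag))‖
      ≤ ‖F (newtonStep g F F' x₀ y α x) - y‖ + 2 * δ
        + L * (‖newtonStep g F F' x₀ y α x - xdag‖ ^ 2
          + ‖x - xdag‖ * ‖newtonStep g F F' x₀ y α x - xdag‖ + ‖x - xdag‖ ^ 2) := by
  have h0 := S.newtonStep_sub hx hα
  have h1 := S.gen.norm_apply_generatorOp_adjoint_le (S.norm_deriv_le x hx) hα
    ((F xdag - y) + (F x - F xdag - F' x (x - xdag)))
  have h2 := norm_add_le (F xdag - y) (F x - F xdag - F' x (x - xdag))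
  have h3 := S.norm_deriv_apply_sub_le hx'
  have h4 := norm_apply_le_add_of_norm_sub_le (norm_sub_rev (F' x) _ ▸ S.norm_deriv_sub_le hx)
    (newtonStep g F F' x₀ y α x - xdag)
  have h5 := norm_add_le (F' x (newtonStep g F F' x₀ y α x - xdag))
    (F' x (generatorOp g α (F' x) (adjoint (F' x)
        ((F xdag - y) + (F x - F xdag - F' x (x - xdag))))))
  rw [← map_add, eq_sub_iff_add_eq.1 h0] at h5
  linarith [S.noise', S.remainder x hx]

theorem sq_norm_residualOp_le (hx : x ∈ Metric.ball xdag ρ) (hα : 0 < α) :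
    ‖residualOp g α (F' x) (x₀ - xdag)‖ ^ 2 ≤ ‖u‖ *
      (‖F' x (residualOp g α (F' x) (x₀ - xdag))‖
        + L * ‖x - xdag‖ * ‖residualOp g α (F' x) (x₀ - xdag)‖) := by
  have h1 := S.gen.norm_residualOp_adjoint_sq_le (S.norm_deriv_le x hx) hα
    (S.norm_deriv_sub_le hx) u
  rwa [← S.source] at h1

/-- Comparison with a smaller regularization parameter, at which the filter may be evaluated at
`xdag` instead of `x`. -/
theorem norm_residualOp_le_of_le {α' : ℝ} (hx : x ∈ Metric.ball xdag ρ) (hα' : 0 < α')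
    (hαα : α' ≤ α) :
    ‖residualOp g α (F' x) (x₀ - xdag)‖ ≤ ‖residualOp g α' (F' xdag) (x₀ - xdag)‖
      + c 6 * (L * ‖x - xdag‖) * ‖u‖
      + c 2 * (√α')⁻¹ * ‖F' x (residualOp g α (F' x) (x₀ - xdag))‖ := by
  have h1 := S.gen.norm_residualOp_le_add (S.c_pos 2).le (S.norm_deriv_le x hx) hα' hαα
    (x₀ - xdag)
  have h2 := S.norm_residualOp_sub_residualOp_le hx hα'
  have h3 := norm_le_norm_add_norm_sub' (residualOp g α' (F' x) (x₀ - xdag))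
    (residualOp g α' (F' xdag) (x₀ - xdag))
  linarith

theorem norm_sub_sq_le : ‖x₀ - xdag‖ ^ 2 ≤ ‖u‖ * ‖F' xdag (x₀ - xdag)‖ := by
  rw [← inner_self_eq_norm_sq (𝕜 := 𝕜)]
  nth_rw 1 [S.source]
  rw [ContinuousLinearMap.adjoint_inner_left]
  exact (RCLike.re_le_norm _).trans (norm_inner_le_norm _ _)

end NewtonSetting

end NewtonStep

/-! ### Constants and parameters -/

section Constants

/-- The requirements on the auxiliary constants: `γ` governs the comparison index (the first `n`
with `γ ‖u‖ α_n ≤ δ`), `K` is the constant of the a priori bound `‖x_j - xdag‖ ≤ K √(α_j) ‖u‖`, and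
`η` stands for `L ‖u‖`, which has to be small relative to everything else. -/
structure AdmissibleConstants (c : Fin 7 → ℝ) (r τ γ K η : ℝ) : Prop where
  r_gt : 1 < r
  tau_gt : 1 < τ
  c_pos : ∀ i, 0 < c i
  c5_gt : 1 < c 5
  gamma_pos : 0 < γ
  gamma_ge : 2 * (c 0 + 1) * r ≤ γ * (τ - 1)
  K_ge : 2 * √r * (c 3 + c 4 * γ) ≤ K
  eta_nonneg : 0 ≤ η
  eta_le : 2 * η ≤ 1
  eta_c0_le : η * c 0 ≤ 1
  small_apriori : η * (K + c 4 * K ^ 2) ≤ c 3 + c 4 * γ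
  small_K : 4 * (c 4 * (η * K)) ≤ 1
  small_K_tau : 4 * (c 4 * (η * K)) ≤ τ - 1
  small_residual : η * (4 * K ^ 2 + 2 * c 3 * K) ≤ 1
  small_comm : 4 * c 5 * (η * (c 6 + c 4 * K)) ≤ 1
  small_sq : η * (24 * (4 * c 5 + 4 * c 4) ^ 2) ≤ 1
  small_gamma : η * (6 * (4 * c 5 + 4 * c 4) ^ 2 * γ) ≤ 1
  small_c6 : η * (2 * c 6 * (4 * c 5 + 4 * c 4)) ≤ 1
  small_rate : η * (3 * K + 2 * c 6) ≤ 1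
  small_rate_tau : 8 * c 4 * (η * (3 * K + 2 * c 6)) ≤ τ - 1

theorem AdmissibleConstants.K_pos {c : Fin 7 → ℝ} {r τ γ K η : ℝ}
    (H : AdmissibleConstants c r τ γ K η) : 0 < K := by
  refine lt_of_lt_of_le ?_ H.K_ge
  have := H.c_pos 3
  have := H.c_pos 4
  have := H.gamma_pos
  have : 0 < √r := Real.sqrt_pos.2 (by linarith [H.r_gt])
  positivity

theorem exists_admissibleConstants {c : Fin 7 → ℝ} {r τ : ℝ} (hr : 1 < r) (hτ : 1 < τ)
    (hc : ∀ i, 0 < c i) (hc5 : 1 < c 5) :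
    ∃ γ > 0, ∃ K > 0, ∃ η₀ > 0, ∀ η, 0 ≤ η → η ≤ η₀ → AdmissibleConstants c r τ γ K η := by
  have h0 := hc 0
  have h3 := hc 3
  have h4 := hc 4
  have h5 := hc 5
  have h6 := hc 6
  have hτ' : 0 < τ - 1 := by linarith
  have hr0 : 0 < r := by linarith
  have hγ : 0 < 2 * (c 0 + 1) * r / (τ - 1) := by positivity
  obtain ⟨γ, hγd⟩ : ∃ γ, γ = 2 * (c 0 + 1) * r / (τ - 1) := ⟨_, rfl⟩
  rw [← hγd] at hγ
  have hsr : 0 < √r := Real.sqrt_pos.2 hr0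
  have hK : 0 < 2 * √r * (c 3 + c 4 * γ) := by positivity
  obtain ⟨K, hKd⟩ : ∃ K, K = 2 * √r * (c 3 + c 4 * γ) := ⟨_, rfl⟩
  rw [← hKd] at hK
  have key : ∀ {N X Y η : ℝ}, 0 ≤ η → η ≤ 1 / N → 0 < N → 0 < Y → X / Y ≤ N → η * X ≤ Y := by
    intro N X Y η hη hηN hN hY hX
    rw [div_le_iff₀ hY] at hX
    rw [le_div_iff₀ hN] at hηN
    nlinarith [mul_le_mul_of_nonneg_left hX hη, mul_le_mul_of_nonneg_right hηN hY.le]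
  obtain ⟨N, hN⟩ : ∃ N, N = 2 + c 0 + (K + c 4 * K ^ 2) / (c 3 + c 4 * γ) + 4 * c 4 * K
    + 4 * c 4 * K / (τ - 1) + (4 * K ^ 2 + 2 * c 3 * K) + 4 * c 5 * (c 6 + c 4 * K)
    + 24 * (4 * c 5 + 4 * c 4) ^ 2 + 6 * (4 * c 5 + 4 * c 4) ^ 2 * γ
    + 2 * c 6 * (4 * c 5 + 4 * c 4) + (3 * K + 2 * c 6)
    + 8 * c 4 * (3 * K + 2 * c 6) / (τ - 1) := ⟨_, rfl⟩
  have p1 : 0 < (K + c 4 * K ^ 2) / (c 3 + c 4 * γ) := by positivity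
  have p2 : 0 < 4 * c 4 * K := by positivity
  have p3 : 0 < 4 * c 4 * K / (τ - 1) := by positivity
  have p4 : 0 < 4 * K ^ 2 + 2 * c 3 * K := by positivity
  have p5 : 0 < 4 * c 5 * (c 6 + c 4 * K) := by positivity
  have p6 : 0 < 24 * (4 * c 5 + 4 * c 4) ^ 2 := by positivity
  have p7 : 0 < 6 * (4 * c 5 + 4 * c 4) ^ 2 * γ := by positivity
  have p8 : 0 < 2 * c 6 * (4 * c 5 + 4 * c 4) := by positivity
  have p9 : 0 < 3 * K + 2 * c 6 := by positivity
  have p10 : 0 < 8 * c 4 * (3 * K + 2 * c 6) / (τ - 1) := by positivity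
  have hNp : 0 < N := by linarith
  refine ⟨γ, hγ, K, hK, 1 / N, by positivity, fun η hη hηN => ?_⟩
  have k1 : ∀ {X : ℝ}, X ≤ N → η * X ≤ 1 := fun h => key hη hηN hNp one_pos (by simpa using h)
  have kτ : ∀ {X : ℝ}, X / (τ - 1) ≤ N → η * X ≤ τ - 1 := fun h => key hη hηN hNp hτ' h
  exact
  { r_gt := hr
    tau_gt := hτ
    c_pos := hc
    c5_gt := hc5
    gamma_pos := hγ
    gamma_ge := by rw [hγd]; field_simp; exact le_rfl
    K_ge := hKd.ge
    eta_nonneg := hη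
    eta_le := by linarith [k1 (X := 2) (by linarith)]
    eta_c0_le := k1 (by linarith)
    small_apriori := key hη hηN hNp (by positivity) (by linarith)
    small_K := by linarith [k1 (X := 4 * c 4 * K) (by linarith)]
    small_K_tau := by linarith [kτ (X := 4 * c 4 * K) (by linarith)]
    small_residual := k1 (by linarith)
    small_comm := by linarith [k1 (X := 4 * c 5 * (c 6 + c 4 * K)) (by linarith)]
    small_sq := k1 (by linarith)
    small_gamma := k1 (by linarith)
    small_c6 := k1 (by linarith)
    small_rate := k1 (by linarith)
    small_rate_tau := by linarith [kτ (X := 8 * c 4 * (3 * K + 2 * c 6)) (by linarith)] }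

/-- The parameter balancing `α ^ ν w` against `α ^ (-1/2) δ`; both then equal the optimal rate. -/
theorem exists_balanced_parameter {ν w δ : ℝ} (hν : 0 < ν) (hw : 0 < w) (hδ : 0 < δ) :
    ∃ a > 0, a ^ ν * w = w ^ (1 / (1 + 2 * ν)) * δ ^ (2 * ν / (1 + 2 * ν)) ∧
      (√a)⁻¹ * δ = w ^ (1 / (1 + 2 * ν)) * δ ^ (2 * ν / (1 + 2 * ν)) := by
  have hm : 0 < 1 + 2 * ν := by linarith
  have hx : 0 < δ / w := by positivity
  have e1 : 2 * ν / (1 + 2 * ν) = 1 - 1 / (1 + 2 * ν) := by field_simp; ring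
  refine ⟨(δ / w) ^ (2 / (1 + 2 * ν)), by positivity, ?_, ?_⟩
  · rw [← Real.rpow_mul hx.le, show 2 / (1 + 2 * ν) * ν = 2 * ν / (1 + 2 * ν) by ring,
      Real.div_rpow hδ.le hw.le, e1, Real.rpow_sub hw, Real.rpow_one]
    field_simp
  · rw [Real.sqrt_eq_rpow, ← Real.rpow_mul hx.le,
      show 2 / (1 + 2 * ν) * (1 / 2) = 1 / (1 + 2 * ν) by ring,
      Real.div_rpow hδ.le hw.le, e1, Real.rpow_sub hδ, Real.rpow_one]
    field_simp

end Constants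

/-! ### Real inequalities for the induction steps -/

section Scalars

variable {c : Fin 7 → ℝ} {r τ γ K L U δ s s' a a' : ℝ}

theorem lipschitz_mul_sq_le (hL : 0 ≤ L) (ha0 : 0 ≤ a) (ha : a ≤ K * s * U) :
    L * a ^ 2 ≤ L * U * K * (s * a) := by
  nlinarith [mul_le_mul_of_nonneg_left ha (mul_nonneg hL ha0)]

theorem inv_mul_add_lipschitz_mul_sq_le (hL : 0 ≤ L) (hs : 0 < s) (ha0 : 0 ≤ a)
    (ha : a ≤ K * s * U) : s⁻¹ * (δ + L * a ^ 2) ≤ s⁻¹ * δ + L * U * K * a := by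
  have h := mul_le_mul_of_nonneg_left (lipschitz_mul_sq_le hL ha0 ha) (inv_pos.2 hs).le
  have e : s⁻¹ * (L * U * K * (s * a)) = L * U * K * a := by field_simp
  rw [mul_add]
  linarith

/-- Induction step of the a priori bound; `s` and `s'` stand for `√(α_k)` and `√(α_{k+1})`. -/
theorem AdmissibleConstants.apriori_step (H : AdmissibleConstants c r τ γ K (L * U))
    (hL : 0 ≤ L) (hU : 0 ≤ U) (hs : 0 < s) (hss : s ≤ √r * s') (ha0 : 0 ≤ a)
    (ha : a ≤ K * s * U) (hδ : δ ≤ γ * U * s ^ 2)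
    (h : a' ≤ (c 3 * s + L * a) * U + c 4 * s⁻¹ * (δ + L * a ^ 2)) : a' ≤ K * s' * U := by
  have h3 := H.c_pos 3
  have h4 := H.c_pos 4
  have hγ := H.gamma_pos
  have hη := H.eta_nonneg
  have hK := H.K_pos
  have q := mul_le_mul_of_nonneg_left
    (inv_mul_add_lipschitz_mul_sq_le (δ := δ) hL hs ha0 ha) h4.le
  have hδs : s⁻¹ * δ ≤ γ * U * s := by
    rw [inv_mul_le_iff₀ hs]; linarith
  have hLa : L * U * a ≤ L * U * (K * s * U) := mul_le_mul_of_nonneg_left ha hη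
  have hsU : 0 ≤ s * U := by positivity
  calc a' ≤ c 3 * s * U + L * U * a + c 4 * (s⁻¹ * δ + L * U * K * a) := by linarith
    _ ≤ c 3 * s * U + L * U * (K * s * U)
        + c 4 * (γ * U * s + K * (L * U * (K * s * U))) := by
        have e : L * U * K * a = K * (L * U * a) := by ring
        rw [e]
        gcongr
    _ = (c 3 + c 4 * γ + L * U * (K + c 4 * K ^ 2)) * (s * U) := by ring
    _ ≤ (2 * (c 3 + c 4 * γ)) * (s * U) := by
        gcongr
        linarith [H.small_apriori]
    _ ≤ (2 * (c 3 + c 4 * γ)) * (√r * s' * U) := by gcongr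
    _ = 2 * √r * (c 3 + c 4 * γ) * (s' * U) := by ring
    _ ≤ K * (s' * U) := by
        have : 0 ≤ s' := by
          by_contra hneg
          push Not at hneg
          nlinarith [Real.sqrt_nonneg r]
        gcongr
        exact H.K_ge
    _ = K * s' * U := by ring

theorem lipschitz_mul_le (hL : 0 ≤ L) (ha : a ≤ K * s * U) : L * a ≤ L * U * K * s := by
  linarith [mul_le_mul_of_nonneg_left ha hL]

theorem AdmissibleConstants.coeff_le (H : AdmissibleConstants c r τ γ K (L * U))
    (hL : 0 ≤ L) (hs : 0 < s) (ha : a ≤ K * s * U) :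
    c 4 * s⁻¹ * (L * a) ≤ c 4 * (L * U * K) := by
  rw [mul_assoc]
  refine mul_le_mul_of_nonneg_left ?_ (H.c_pos 4).le
  rw [inv_mul_le_iff₀ hs]
  linarith [lipschitz_mul_le hL ha]

/-- If the parameter is of the order `δ / U`, then the residual `f` after the step is at most `τ δ`:
the noise contributes little more than `δ`, and the rest is small by the choice of `γ`. -/
theorem AdmissibleConstants.residual_step (H : AdmissibleConstants c r τ γ K (L * U))
    (hL : 0 ≤ L) (hU : 0 ≤ U) (hδ0 : 0 ≤ δ) (hs : 0 < s) (ha0 : 0 ≤ a) (ha'0 : 0 ≤ a')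
    (ha : a ≤ K * s * U) (ha' : a' ≤ K * s * U) (hδ : γ * U * s ^ 2 ≤ r * δ) {f : ℝ}
    (h : f ≤ L * a' ^ 2 + (c 0 * s ^ 2 + 2 * c 3 * s * (L * a) + (L * a) ^ 2) * U
      + (1 + c 4 * s⁻¹ * (L * a)) * (δ + L * a ^ 2)) : f ≤ τ * δ := by
  have h0 := H.c_pos 0
  have h3 := H.c_pos 3
  have h4 := H.c_pos 4
  have hη := H.eta_nonneg
  have hK := H.K_pos
  have hγ := H.gamma_pos
  have hηK : 0 ≤ L * U * K := by positivity
  obtain ⟨W, hW⟩ : ∃ W, W = s ^ 2 * U := ⟨_, rfl⟩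
  have hW0 : 0 ≤ W := by rw [hW]; positivity
  have hsa : ∀ b, b ≤ K * s * U → s * b ≤ K * W := fun b hb => by
    have := mul_le_mul_of_nonneg_left hb hs.le
    rw [hW]; linarith
  have q1 : L * a ^ 2 ≤ L * U * K * (K * W) :=
    (lipschitz_mul_sq_le hL ha0 ha).trans (mul_le_mul_of_nonneg_left (hsa a ha) hηK)
  have q2 : L * a' ^ 2 ≤ L * U * K * (K * W) :=
    (lipschitz_mul_sq_le hL ha'0 ha').trans (mul_le_mul_of_nonneg_left (hsa a' ha') hηK)
  have q3 := lipschitz_mul_le hL ha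
  have q4 : (L * a) ^ 2 * U ≤ (L * U * K * s) ^ 2 * U := by gcongr
  have q5 : (L * U * K * s) ^ 2 * U = (L * U) * (L * U * K * (K * W)) := by rw [hW]; ring
  have q6 : (L * U) * (L * U * K * (K * W)) ≤ 1 * (L * U * K * (K * W)) :=
    mul_le_mul_of_nonneg_right (by linarith [H.eta_le]) (by positivity)
  have q7 : 2 * c 3 * s * (L * a) * U ≤ 2 * c 3 * s * (L * U * K * s) * U := by gcongr
  have q8 := H.coeff_le hL hs ha
  have q9 : (1 + c 4 * s⁻¹ * (L * a)) * (δ + L * a ^ 2)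
      ≤ (1 + c 4 * (L * U * K)) * (δ + L * U * K * (K * W)) := by gcongr
  have q10 : c 4 * (L * U * K) * (L * U * K * (K * W)) ≤ 1 * (L * U * K * (K * W)) :=
    mul_le_mul_of_nonneg_right (by linarith [H.small_K]) (by positivity)
  have q11 : c 4 * (L * U * K) * δ ≤ (τ - 1) / 4 * δ :=
    mul_le_mul_of_nonneg_right (by linarith [H.small_K_tau]) hδ0
  have q12 : (L * U * (4 * K ^ 2 + 2 * c 3 * K)) * W ≤ 1 * W :=
    mul_le_mul_of_nonneg_right H.small_residual hW0
  -- `(c₀ + 1) W ≤ (τ - 1) / 2 * δ`, by the choice of `γ`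
  have q13 : (c 0 + 1) * W ≤ (τ - 1) / 2 * δ := by
    have e1 := mul_le_mul_of_nonneg_right H.gamma_ge hW0
    have e2 := mul_le_mul_of_nonneg_right hδ (by linarith [H.tau_gt] : 0 ≤ τ - 1)
    have e3 : 2 * (c 0 + 1) * r * W ≤ r * δ * (τ - 1) := by
      calc _ ≤ _ := e1
        _ = γ * U * s ^ 2 * (τ - 1) := by rw [hW]; ring
        _ ≤ _ := e2
    have hr : 0 < r := by linarith [H.r_gt]
    refine le_of_mul_le_mul_left ?_ (by linarith : 0 < 2 * r)
    linarith
  have e1 : 2 * c 3 * s * (L * U * K * s) * U = L * U * (2 * c 3 * K) * W := by rw [hW]; ring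
  have e2 : c 0 * s ^ 2 * U = c 0 * W := by rw [hW]; ring
  have e3 : L * U * K * (K * W) = L * U * K ^ 2 * W := by ring
  have hτδ : 0 ≤ (τ - 1) * δ := mul_nonneg (by linarith [H.tau_gt]) hδ0
  rw [e3] at q1 q2 q5 q6 q9 q10
  have : f ≤ L * U * K ^ 2 * W + (c 0 * W + L * U * (2 * c 3 * K) * W + L * U * K ^ 2 * W)
      + (δ + (τ - 1) / 4 * δ + 2 * (L * U * K ^ 2 * W)) := by linarith
  linarith

/-- The analogue of `residual_step` when the comparison index is zero. -/
theorem AdmissibleConstants.residual_initial (H : AdmissibleConstants c r τ γ K (L * U))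
    (hc3 : c 3 ^ 2 ≤ c 0) (hL : 0 ≤ L) (hU : 0 ≤ U) (hδ0 : 0 ≤ δ) (hs : 0 < s) (ha0 : 0 ≤ a)
    (ha : a ≤ c 3 * s * U) (hδ : γ * U * s ^ 2 ≤ δ) {f b : ℝ} (hb : b ≤ c 3 * s * a)
    (h : f ≤ δ + b + L * a ^ 2) : f ≤ τ * δ := by
  have h0 := H.c_pos 0
  have h3 := H.c_pos 3
  obtain ⟨W, hW⟩ : ∃ W, W = s ^ 2 * U := ⟨_, rfl⟩
  have hW0 : 0 ≤ W := by rw [hW]; positivity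
  have q1 : b ≤ c 0 * W := by
    calc b ≤ c 3 * s * (c 3 * s * U) := hb.trans (by gcongr)
      _ = c 3 ^ 2 * W := by rw [hW]; ring
      _ ≤ c 0 * W := by gcongr
  have q2 : L * a ^ 2 ≤ 1 * W := by
    calc L * a ^ 2 ≤ L * (c 3 * s * U) ^ 2 := by gcongr
      _ = L * U * c 3 ^ 2 * W := by rw [hW]; ring
      _ ≤ L * U * c 0 * W := by have := H.eta_nonneg; gcongr
      _ ≤ 1 * W := by gcongr; exact H.eta_c0_le
  have q3 : (c 0 + 1) * W ≤ (τ - 1) / 2 * δ := by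
    have e1 := mul_le_mul_of_nonneg_right H.gamma_ge hW0
    have e2 := mul_le_mul_of_nonneg_right hδ (by linarith [H.tau_gt] : 0 ≤ τ - 1)
    have e3 : 2 * ((c 0 + 1) * W) ≤ 2 * ((c 0 + 1) * W) * r :=
      le_mul_of_one_le_right (by positivity) H.r_gt.le
    have e4 : γ * (τ - 1) * W = γ * U * s ^ 2 * (τ - 1) := by rw [hW]; ring
    linarith
  have hτδ : 0 ≤ (τ - 1) * δ := mul_nonneg (by linarith [H.tau_gt]) hδ0
  linarith

/-- Induction step of the comparison with the linear problem; `t` and `t'` are the norms of its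
filtered initial errors for the parameters `s ^ 2` and `s' ^ 2`. -/
theorem AdmissibleConstants.error_step (H : AdmissibleConstants c r τ γ K (L * U))
    (hL : 0 ≤ L) (hδ0 : 0 ≤ δ) (hs : 0 < s) (hs' : 0 < s') (hss : s' ≤ s)
    (ha0 : 0 ≤ a) (ha : a ≤ K * s * U) {t t' : ℝ} (ht0 : 0 ≤ t) (htt : t ≤ c 5 * t')
    (hat : a ≤ 2 * c 5 * t + 2 * c 4 * (s⁻¹ * δ))
    (h : a' ≤ t + c 6 * (L * a) * U + c 4 * s⁻¹ * (δ + L * a ^ 2)) :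
    a' ≤ 2 * c 5 * t' + 2 * c 4 * (s'⁻¹ * δ) := by
  have h4 := H.c_pos 4
  have h5 := H.c5_gt
  have h6 := H.c_pos 6
  have hK := H.K_pos
  have hη := H.eta_nonneg
  obtain ⟨ε, hε⟩ : ∃ ε, ε = L * U * (c 6 + c 4 * K) := ⟨_, rfl⟩
  have hε0 : 0 ≤ ε := by rw [hε]; positivity
  have hε1 : 4 * c 5 * ε ≤ 1 := by rw [hε]; exact H.small_comm
  have hsδ : 0 ≤ s⁻¹ * δ := by positivity
  have q1 := mul_le_mul_of_nonneg_left
    (inv_mul_add_lipschitz_mul_sq_le (δ := δ) hL hs ha0 ha) h4.le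
  have q2 : a' ≤ t + ε * a + c 4 * (s⁻¹ * δ) := by rw [hε]; linarith
  have q3 := mul_le_mul_of_nonneg_left hat hε0
  have q4 : ε * c 5 * t ≤ 1 / 4 * t := mul_le_mul_of_nonneg_right (by linarith) ht0
  have hε2 : ε ≤ 1 / 4 := by nlinarith
  have q5 : ε * (c 4 * (s⁻¹ * δ)) ≤ 1 / 4 * (c 4 * (s⁻¹ * δ)) :=
    mul_le_mul_of_nonneg_right hε2 (by positivity)
  have q6 : s⁻¹ * δ ≤ s'⁻¹ * δ := by gcongr
  have q7 := mul_le_mul_of_nonneg_left q6 h4.le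
  have q8 : 0 ≤ c 4 * (s⁻¹ * δ) := by positivity
  linarith

/-- If `q` exceeds `E` only by a quadratic remainder in `p` and `v`, and `L p ^ 2` is in turn
bounded by a small multiple of `q`, then the remainder can be absorbed. -/
theorem le_of_quadratic_remainder {M η p v q E G : ℝ} (hL : 0 ≤ L) (hM : 4 ≤ M) (hη : 0 ≤ η)
    (hp : 0 ≤ p) (hv : 0 ≤ v) (hq : 0 ≤ q) (ha : 0 ≤ a) (ha' : 0 ≤ a') (haM : a ≤ M * (p + v))
    (haM' : a' ≤ M * (p + v)) (hG : L * v ^ 2 ≤ G) (hLp : L * p ^ 2 ≤ η * (q + L * a * p))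
    (hqE : q ≤ E + L * (a' ^ 2 + a * a' + a ^ 2)) (hsq : η * (24 * M ^ 2) ≤ 1) :
    q ≤ 2 * E + 24 * M ^ 2 * G := by
  have hM0 : 0 ≤ M := by linarith
  have hpv1 : (p + v) * p ≤ 2 * p ^ 2 + v ^ 2 := by nlinarith [sq_nonneg (p - v)]
  have hpv2 : (p + v) ^ 2 ≤ 2 * (p ^ 2 + v ^ 2) := by nlinarith [sq_nonneg (p - v)]
  have hηM0 : 0 ≤ η * M := by positivity
  have hηM : 4 * (η * M) ≤ 1 := by
    have : η * M * 4 ≤ η * M * M := mul_le_mul_of_nonneg_left hM hηM0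
    linarith [mul_nonneg hηM0 hM0]
  have h1 : L * p ^ 2 ≤ 2 * η * q + G := by
    have e3 : a * p ≤ M * (2 * p ^ 2 + v ^ 2) := by
      calc a * p ≤ M * (p + v) * p := by gcongr
        _ = M * ((p + v) * p) := by ring
        _ ≤ _ := by gcongr
    have e4 : η * (L * (a * p)) ≤ η * (L * (M * (2 * p ^ 2 + v ^ 2))) := by gcongr
    have e5 : η * (L * (M * (2 * p ^ 2 + v ^ 2)))
        = 2 * (η * M) * (L * p ^ 2) + η * M * (L * v ^ 2) := by ring
    have e6 : 4 * (η * M) * (L * p ^ 2) ≤ 1 * (L * p ^ 2) :=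
      mul_le_mul_of_nonneg_right hηM (by positivity)
    have e7 : 4 * (η * M) * (L * v ^ 2) ≤ 1 * (L * v ^ 2) :=
      mul_le_mul_of_nonneg_right hηM (by positivity)
    have e8 : 0 ≤ L * v ^ 2 := by positivity
    linarith
  have h2 : a' ^ 2 + a * a' + a ^ 2 ≤ 6 * M ^ 2 * (p ^ 2 + v ^ 2) := by
    have e1 : a ^ 2 ≤ (M * (p + v)) ^ 2 := by gcongr
    have e2 : a' ^ 2 ≤ (M * (p + v)) ^ 2 := by gcongr
    have e3 : a * a' ≤ (M * (p + v)) * (M * (p + v)) := by gcongr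
    have e4 : M ^ 2 * (p + v) ^ 2 ≤ M ^ 2 * (2 * (p ^ 2 + v ^ 2)) := by gcongr
    linarith
  have e1 := mul_le_mul_of_nonneg_left h2 hL
  have e2 := mul_le_mul_of_nonneg_left h1 (by positivity : 0 ≤ 6 * M ^ 2)
  have e3 := mul_le_mul_of_nonneg_left hG (by positivity : 0 ≤ 6 * M ^ 2)
  have e4 := mul_le_mul_of_nonneg_right hsq hq
  linarith

/-- The estimate at the stopping index. Here `a`, `a'` are the errors before and after the last
step, `p` is the norm of the filtered initial error at the last but one iterate, `q` the norm of its
image under the derivative there, and `f` the final residual norm. Since the discrepancy principle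
bounds `f` by `τ δ`, the quantity `q` is of order `δ`. -/
theorem AdmissibleConstants.final_step (H : AdmissibleConstants c r τ γ K (L * U))
    (hL : 0 ≤ L) (hδ0 : 0 ≤ δ) (hs : 0 < s) (ha0 : 0 ≤ a) (ha'0 : 0 ≤ a')
    (ha : a ≤ K * s * U) (hδ : δ ≤ γ * U * s ^ 2) {t p q f : ℝ} (hp0 : 0 ≤ p) (hq0 : 0 ≤ q)
    (hat : a ≤ 2 * c 5 * t + 2 * c 4 * (s⁻¹ * δ))
    (htp : t ≤ p + c 6 * (L * a) * U)
    (hap : a' ≤ p + c 4 * s⁻¹ * (δ + L * a ^ 2))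
    (hpq : p ^ 2 ≤ U * (q + L * a * p))
    (hqf : q ≤ f + 2 * δ + L * (a' ^ 2 + a * a' + a ^ 2))
    (hf : f ≤ τ * δ) :
    a' ≤ (4 * c 5 + 4 * c 4) * (p + s⁻¹ * δ) ∧
      c 6 * (L * a) * U ≤ 1 / 2 * (p + s⁻¹ * δ) ∧ q ≤ 2 * (τ + 4) * δ := by
  have h4 := H.c_pos 4
  have h5 := H.c5_gt
  have h6 := H.c_pos 6
  have hK := H.K_pos
  have hη := H.eta_nonneg
  obtain ⟨η, hηd⟩ : ∃ η, η = L * U := ⟨_, rfl⟩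
  obtain ⟨v, hv⟩ : ∃ v, v = s⁻¹ * δ := ⟨_, rfl⟩
  obtain ⟨M, hM⟩ : ∃ M, M = 4 * c 5 + 4 * c 4 := ⟨_, rfl⟩
  have hv0 : 0 ≤ v := by rw [hv]; positivity
  have hM4 : 4 ≤ M := by linarith
  have hcomm := H.small_comm
  have hsmK := H.small_K
  have hsq := H.small_sq
  have hsg := H.small_gamma
  have hs6 := H.small_c6
  have q1 := mul_le_mul_of_nonneg_left
    (inv_mul_add_lipschitz_mul_sq_le (δ := δ) hL hs ha0 ha) h4.le
  rw [← hηd] at hη hcomm hsmK hsq hsg hs6 q1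
  rw [← hM] at hsq hsg hs6
  rw [← hv] at hat q1
  have e6 : c 6 * (L * a) * U = c 6 * η * a := by rw [hηd]; ring
  rw [e6] at htp
  -- the old error in terms of `p` and `v`
  have h56 : 4 * c 5 * (c 6 * η) ≤ 1 := by
    have : 0 ≤ c 5 * (η * (c 4 * K)) := by positivity
    linarith
  have ha1 : a ≤ 4 * c 5 * p + 4 * c 4 * v := by
    have e1 := mul_le_mul_of_nonneg_left htp (by linarith : 0 ≤ 2 * c 5)
    have e2 := mul_le_mul_of_nonneg_right h56 ha0
    linarith
  have hpv0 : 0 ≤ p + v := by positivity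
  have haM : a ≤ M * (p + v) := by
    have e1 : 0 ≤ c 4 * p := by positivity
    have e2 : 0 ≤ c 5 * v := by positivity
    rw [hM]; linarith
  have haM' : a' ≤ M * (p + v) := by
    have e1 := mul_le_mul_of_nonneg_right hsmK ha0
    have e2 : 0 ≤ c 4 * p := by positivity
    have e3 : 0 ≤ c 5 * v := by positivity
    have e4 := mul_le_mul_of_nonneg_right h5.le hp0
    have e5 : 0 ≤ c 4 * v := by positivity
    rw [hM]; linarith
  -- `L v ^ 2` is of order `δ`
  have hLv : L * v ^ 2 ≤ γ * η * δ := by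
    have e1 : v * s = δ := by rw [hv]; field_simp
    have e2 : δ * δ ≤ γ * U * s ^ 2 * δ := mul_le_mul_of_nonneg_right hδ hδ0
    have e3 : v ^ 2 ≤ γ * U * δ := by
      refine le_of_mul_le_mul_right ?_ (by positivity : 0 < s ^ 2)
      calc v ^ 2 * s ^ 2 = δ * δ := by rw [← e1]; ring
        _ ≤ _ := e2
        _ = _ := by ring
    calc L * v ^ 2 ≤ L * (γ * U * δ) := by gcongr
      _ = γ * η * δ := by rw [hηd]; ring
  have hγηδ : 0 ≤ γ * η * δ := by have := H.gamma_pos; positivity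
  have hq : q ≤ 2 * (τ + 4) * δ := by
    have e1 : L * p ^ 2 ≤ η * (q + L * a * p) := by
      calc L * p ^ 2 ≤ L * (U * (q + L * a * p)) := by gcongr
        _ = η * (q + L * a * p) := by rw [hηd]; ring
    have e2 := le_of_quadratic_remainder hL hM4 hη hp0 hv0 hq0 ha0 ha'0 haM haM' hLv e1
      (E := (τ + 2) * δ) (by linarith) hsq
    have e3 := mul_le_mul_of_nonneg_right hsg hδ0
    linarith
  rw [e6, ← hv, ← hM]
  refine ⟨haM', ?_, hq⟩
  have e1 := mul_le_mul_of_nonneg_left haM (by positivity : 0 ≤ c 6 * η)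
  have e2 := mul_le_mul_of_nonneg_right hs6 hpv0
  linarith

/-- Before the stopping index, where the residual exceeds `τ δ`, the noise level is bounded by the
smoothness term. -/
theorem AdmissibleConstants.noise_le_step (H : AdmissibleConstants c r τ γ K (L * U))
    (hL : 0 ≤ L) (hU : 0 ≤ U) (hδ0 : 0 ≤ δ) (hs : 0 < s) (hs' : 0 < s') (ha0 : 0 ≤ a) (ha'0 : 0 ≤ a')
    (ha : a ≤ K * s * U) (ha' : a' ≤ K * s' * U) {t t' W V f : ℝ}
    (htW : s * t ≤ W) (htW' : s' * t' ≤ W) (hV : V ≤ W) (hW : 0 ≤ W)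
    (hat : a ≤ 2 * c 5 * t + 2 * c 4 * (s⁻¹ * δ))
    (hat' : a' ≤ 2 * c 5 * t' + 2 * c 4 * (s'⁻¹ * δ))
    (hf : τ * δ < f)
    (h : f ≤ L * a' ^ 2 + V + c 6 * (s + L * a) * (L * a) * U
      + (1 + c 4 * s⁻¹ * (L * a)) * (δ + L * a ^ 2)) :
    (τ - 1) * δ ≤ 2 * (3 + 2 * c 5) * W := by
  have h4 := H.c_pos 4
  have h5 := H.c5_gt
  have h6 := H.c_pos 6
  have hK := H.K_pos
  have hη := H.eta_nonneg
  obtain ⟨Q, hQ⟩ : ∃ Q, Q = 2 * c 5 * W + 2 * c 4 * δ := ⟨_, rfl⟩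
  have hsa : ∀ {σ b T : ℝ}, 0 < σ → σ * T ≤ W → b ≤ 2 * c 5 * T + 2 * c 4 * (σ⁻¹ * δ) →
      σ * b ≤ Q := by
    intro σ b T hσ hT hb
    have e1 := mul_le_mul_of_nonneg_left hb hσ.le
    have e2 : σ * (2 * c 5 * T + 2 * c 4 * (σ⁻¹ * δ)) = 2 * c 5 * (σ * T) + 2 * c 4 * δ := by
      field_simp
    have e3 := mul_le_mul_of_nonneg_left hT (by linarith : 0 ≤ 2 * c 5)
    rw [hQ]; linarith
  have hQa := hsa hs htW hat
  have hQa' := hsa hs' htW' hat'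
  have hQ0 : 0 ≤ Q := by rw [hQ]; positivity
  have hηK0 : 0 ≤ L * U * K := by positivity
  have hηK1 : L * U * K ≤ 1 := by
    have e : 0 ≤ L * U * (2 * K + 2 * c 6) := by positivity
    linarith [H.small_rate]
  have q1 : L * a ^ 2 ≤ L * U * K * Q :=
    (lipschitz_mul_sq_le hL ha0 ha).trans (mul_le_mul_of_nonneg_left hQa hηK0)
  have q2 : L * a' ^ 2 ≤ L * U * K * Q :=
    (lipschitz_mul_sq_le hL ha'0 ha').trans (mul_le_mul_of_nonneg_left hQa' hηK0)
  have q3 := lipschitz_mul_le hL ha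
  have q4 : c 6 * (s + L * a) * (L * a) * U ≤ 2 * c 6 * (L * U) * Q := by
    have e1 : L * a ≤ 1 * s := q3.trans (mul_le_mul_of_nonneg_right hηK1 hs.le)
    calc c 6 * (s + L * a) * (L * a) * U ≤ c 6 * (s + 1 * s) * (L * a) * U := by gcongr
      _ = 2 * c 6 * (L * U) * (s * a) := by ring
      _ ≤ 2 * c 6 * (L * U) * Q := by gcongr
  have q5 := H.coeff_le hL hs ha
  have q6 : (1 + c 4 * s⁻¹ * (L * a)) * (δ + L * a ^ 2)
      ≤ (1 + c 4 * (L * U * K)) * (δ + L * U * K * Q) := by gcongr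
  have q7 : c 4 * (L * U * K) * (L * U * K * Q) ≤ 1 * (L * U * K * Q) :=
    mul_le_mul_of_nonneg_right (by linarith [H.small_K]) (by positivity)
  have q8 : c 4 * (L * U * K) * δ ≤ (τ - 1) / 4 * δ :=
    mul_le_mul_of_nonneg_right (by linarith [H.small_K_tau]) hδ0
  obtain ⟨θ, hθ⟩ : ∃ θ, θ = L * U * (3 * K + 2 * c 6) := ⟨_, rfl⟩
  have hθ1 : θ ≤ 1 := hθ ▸ H.small_rate
  have hθ2 : 8 * c 4 * θ ≤ τ - 1 := hθ ▸ H.small_rate_tau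
  have q9 : τ * δ ≤ W + δ + (τ - 1) / 4 * δ + θ * Q := by rw [hθ]; linarith
  have q10 : θ * (c 5 * W) ≤ 1 * (c 5 * W) := mul_le_mul_of_nonneg_right hθ1 (by positivity)
  have q11 := mul_le_mul_of_nonneg_right hθ2 hδ0
  have q12 : θ * Q = 2 * (θ * (c 5 * W)) + 1 / 4 * (8 * c 4 * θ * δ) := by rw [hQ]; ring
  linarith

end Scalars

/-! ### The Newton iteration -/

section Sequence

open Set
open ContinuousLinearMap (adjoint)

variable {𝕜 X Y : Type*} [RCLike 𝕜]
  [NormedAddCommGroup X] [InnerProductSpace 𝕜 X] [CompleteSpace X]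
  [NormedAddCommGroup Y] [InnerProductSpace 𝕜 Y] [CompleteSpace Y]
  {g : ℝ → ℝ → ℝ} {c : Fin 7 → ℝ} {α : ℕ → ℝ} {F : X → Y} {F' : X → X →L[𝕜] Y}
  {xdag x₀ : X} {ρ L δ r τ γ K : ℝ} {u y : Y}

theorem StepSizeConditions.le_mul {c5 : ℝ} (hα : StepSizeConditions g α r c5) (k : ℕ) :
    α k ≤ r * α (k + 1) :=
  (div_le_iff₀ (hα.pos (k + 1))).1 (hα.ratio_le k)

theorem StepSizeConditions.succ_le {c5 : ℝ} (hα : StepSizeConditions g α r c5) (k : ℕ) :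
    α (k + 1) ≤ α k :=
  (one_le_div (hα.pos (k + 1))).1 (hα.one_le_ratio k)

theorem StepSizeConditions.sqrt_le {c5 : ℝ} (hα : StepSizeConditions g α r c5) (k : ℕ) :
    √(α k) ≤ √r * √(α (k + 1)) := by
  rw [← Real.sqrt_mul' _ (hα.pos (k + 1)).le]
  exact Real.sqrt_le_sqrt (hα.le_mul k)

namespace NewtonSetting

variable (S : NewtonSetting g c F F' xdag x₀ ρ L δ u y)
  (H : AdmissibleConstants c r τ γ K (L * ‖u‖)) (hα : StepSizeConditions g α r (c 5))
  (hA : ‖F' xdag‖ ≤ c 3 * √(α 0))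

include S in
theorem delta_nonneg : 0 ≤ δ := (norm_nonneg _).trans S.noise

include S hA in
theorem norm_sub_le_source : ‖x₀ - xdag‖ ≤ c 3 * √(α 0) * ‖u‖ := by
  rw [S.source]
  exact (adjoint (F' xdag)).le_of_opNorm_le (by rwa [LinearIsometryEquiv.norm_map]) u

include S H hα hA

/-- The a priori bound on the errors up to the comparison index. -/
theorem norm_newtonIter_sub_le {n : ℕ} (hδ : ∀ j < n, δ ≤ γ * ‖u‖ * α j)
    (hball : ∀ j < n, newtonIter g α F F' x₀ y j ∈ Metric.ball xdag ρ) :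
    ∀ j ≤ n, ‖newtonIter g α F F' x₀ y j - xdag‖ ≤ K * √(α j) * ‖u‖ := by
  intro j
  induction j with
  | zero =>
    intro _
    have h3 := S.c_pos 3
    have h4 := S.c_pos 4
    have hγ := H.gamma_pos
    have hc3 : c 3 ≤ K := by
      have h1 : 1 ≤ √r := Real.one_le_sqrt.2 H.r_gt.le
      have h2 : 1 * (c 3 + c 4 * γ) ≤ √r * (c 3 + c 4 * γ) := by gcongr
      have h5 : 0 < c 4 * γ := by positivity
      linarith [H.K_ge]
    refine (S.norm_sub_le_source hA).trans ?_
    gcongr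
  | succ j ih =>
    intro hj
    rw [newtonIter_succ]
    refine H.apriori_step S.L_nonneg (norm_nonneg u) (Real.sqrt_pos.2 (hα.pos j)) (hα.sqrt_le j)
      (norm_nonneg _) (ih (by omega)) ?_
      (S.norm_newtonStep_sub_le_source (hball j (by omega)) (hα.pos j))
    rw [Real.sq_sqrt (hα.pos j).le]
    exact hδ j (by omega)

/-- The iterates stay in the ball: the noise term `δ / √(α_j)` is at most `√(γ ‖u‖ δ)`, hence small
relative to `ρ`. -/
theorem newtonIter_mem_ball {n : ℕ} (hδ : ∀ j < n, δ ≤ γ * ‖u‖ * α j)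
    (hρ : 4 * ‖x₀ - xdag‖ < ρ) (hκ : ‖u‖ * δ ≤ 1 / (16 * c 4 ^ 2 * γ) * ρ ^ 2) :
    ∀ j ≤ n, newtonIter g α F F' x₀ y j ∈ Metric.ball xdag ρ := by
  have h4 := S.c_pos 4
  have hγ := H.gamma_pos
  intro j
  induction j using Nat.strong_induction_on with
  | _ j ih =>
    intro hj
    rw [mem_ball_iff_norm]
    cases j with
    | zero =>
      have := norm_nonneg (x₀ - xdag)
      change ‖x₀ - xdag‖ < ρ
      linarith
    | succ j =>
      have hmem := ih j (by omega) (by omega)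
      have hs := Real.sqrt_pos.2 (hα.pos j)
      have hK := S.norm_newtonIter_sub_le H hα hA (n := j) (fun i hi => hδ i (by omega))
        (fun i hi => ih i (by omega) (by omega)) j le_rfl
      have h1 := S.norm_newtonStep_sub_le_initial hmem (hα.pos j)
      have h2 := mul_le_mul_of_nonneg_left (inv_mul_add_lipschitz_mul_sq_le (δ := δ) S.L_nonneg hs
        (norm_nonneg _) hK) h4.le
      have h3 := mem_ball_iff_norm.1 hmem
      rw [newtonIter_succ]
      set a := ‖newtonIter g α F F' x₀ y j - xdag‖
      have h5 : c 4 * ((√(α j))⁻¹ * δ) ≤ ρ / 4 := by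
        refine le_of_sq_le_sq ?_ (by linarith [S.rho_pos])
        have e1 : δ * δ ≤ γ * ‖u‖ * α j * δ :=
          mul_le_mul_of_nonneg_right (hδ j (by omega)) S.delta_nonneg
        have e2 : ((√(α j))⁻¹ * δ) ^ 2 ≤ γ * (‖u‖ * δ) := by
          rw [mul_pow, inv_pow, Real.sq_sqrt (hα.pos j).le, inv_mul_le_iff₀ (hα.pos j)]
          linarith
        calc (c 4 * ((√(α j))⁻¹ * δ)) ^ 2 = c 4 ^ 2 * ((√(α j))⁻¹ * δ) ^ 2 := by ring
          _ ≤ c 4 ^ 2 * (γ * (1 / (16 * c 4 ^ 2 * γ) * ρ ^ 2)) := by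
            gcongr
            exact e2.trans (by gcongr)
          _ = (ρ / 4) ^ 2 := by field_simp; ring
      have h6 : 4 * (c 4 * (L * ‖u‖ * K)) * a ≤ 1 * a :=
        mul_le_mul_of_nonneg_right H.small_K (norm_nonneg _)
      linarith [S.rho_pos]

/-- At the comparison index the residual is at most `τ δ`. -/
theorem norm_image_newtonIter_sub_le {n : ℕ} (hδ : ∀ j < n, δ ≤ γ * ‖u‖ * α j)
    (hn : γ * ‖u‖ * α n ≤ δ)
    (hball : ∀ j ≤ n, newtonIter g α F F' x₀ y j ∈ Metric.ball xdag ρ) :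
    ‖F (newtonIter g α F F' x₀ y n) - y‖ ≤ τ * δ := by
  have hK := S.norm_newtonIter_sub_le H hα hA hδ (fun j hj => hball j hj.le)
  cases n with
  | zero =>
    have h0 := S.c_pos 0
    have hc3 : c 3 ^ 2 ≤ c 0 := by
      have := pow_le_pow_left₀ (S.c_pos 3).le S.gen.c3_le 2
      rwa [Real.sq_sqrt h0.le] at this
    have hm : x₀ ∈ Metric.ball xdag ρ := hball 0 le_rfl
    refine H.residual_initial hc3 S.L_nonneg (norm_nonneg u) S.delta_nonneg
      (Real.sqrt_pos.2 (hα.pos 0)) (norm_nonneg (x₀ - xdag)) (S.norm_sub_le_source hA) ?_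
      ((F' xdag).le_of_opNorm_le hA (x₀ - xdag)) ?_
    · rwa [Real.sq_sqrt (hα.pos 0).le]
    · have h1 := S.remainder' x₀ hm
      have h2 := S.noise'
      change ‖F x₀ - y‖ ≤ _
      have h3 : ‖F x₀ - y‖ ≤ ‖F xdag - y‖ + ‖F' xdag (x₀ - xdag)‖
          + ‖F x₀ - F xdag - F' xdag (x₀ - xdag)‖ := by
        refine le_of_eq_of_le (congrArg _ ?_)
          ((norm_add_le _ _).trans (add_le_add (norm_add_le _ _) le_rfl))
        abel
      linarith
  | succ j =>
    have hs := Real.sqrt_pos.2 (hα.pos j)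
    have hss : √(α (j + 1)) ≤ √(α j) := Real.sqrt_le_sqrt (hα.succ_le j)
    have hKp := H.K_pos
    have h1 := hK (j + 1) le_rfl
    have h2 : K * √(α (j + 1)) * ‖u‖ ≤ K * √(α j) * ‖u‖ := by gcongr
    have h3 := S.norm_image_newtonStep_sub_le_source (hball j (by omega)) (hα.pos j)
      (hball (j + 1) le_rfl)
    refine H.residual_step S.L_nonneg (norm_nonneg u) S.delta_nonneg hs (norm_nonneg _)
      (norm_nonneg _) (hK j (by omega)) (h1.trans h2) ?_ (f := _) ?_
    · rw [Real.sq_sqrt (hα.pos j).le]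
      have e1 := mul_le_mul_of_nonneg_left (hα.le_mul j)
        (mul_nonneg H.gamma_pos.le (norm_nonneg u))
      have e2 := mul_le_mul_of_nonneg_left hn (by linarith [H.r_gt] : 0 ≤ r)
      linarith
    · rw [Real.sq_sqrt (hα.pos j).le]
      exact h3

/-- The error of each iterate up to the stopping index is controlled by the filtered initial error
of the linear problem at `xdag` and the propagated noise. -/
theorem norm_newtonIter_sub_le_residual {n : ℕ} (hδ : ∀ j < n, δ ≤ γ * ‖u‖ * α j)
    (hball : ∀ j ≤ n, newtonIter g α F F' x₀ y j ∈ Metric.ball xdag ρ)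
    (h0 : ‖x₀ - xdag‖ ≤ 4 / 3 * ‖residualOp g (α 0) (F' xdag) (x₀ - xdag)‖) :
    ∀ j ≤ n, ‖newtonIter g α F F' x₀ y j - xdag‖
      ≤ 2 * c 5 * ‖residualOp g (α j) (F' xdag) (x₀ - xdag)‖ + 2 * c 4 * ((√(α j))⁻¹ * δ) := by
  have hK := S.norm_newtonIter_sub_le H hα hA hδ (fun j hj => hball j hj.le)
  intro j
  induction j with
  | zero =>
    intro _
    have h4 := S.c_pos 4
    have hδ0 := S.delta_nonneg
    have e1 : 0 ≤ 2 * c 4 * ((√(α 0))⁻¹ * δ) := by positivity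
    have e2 := mul_le_mul_of_nonneg_right H.c5_gt.le
      (norm_nonneg (residualOp g (α 0) (F' xdag) (x₀ - xdag)))
    have e3 := norm_nonneg (residualOp g (α 0) (F' xdag) (x₀ - xdag))
    change ‖x₀ - xdag‖ ≤ _
    linarith
  | succ j ih =>
    intro hj
    exact H.error_step S.L_nonneg S.delta_nonneg (Real.sqrt_pos.2 (hα.pos j))
      (Real.sqrt_pos.2 (hα.pos (j + 1))) (Real.sqrt_le_sqrt (hα.succ_le j)) (norm_nonneg _)
      (hK j (by omega)) (norm_nonneg _)
      (S.gen.norm_residualOp_le_mul S.norm_deriv_xdag_le (hα.pos (j + 1)) (hα.pos j)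
        (S.c_pos 5).le (hα.residual_le j) _) (ih (by omega))
      (S.norm_newtonStep_sub_le_residual (hball j (by omega)) (hα.pos j))

/-- The error at a stopping index `k + 1`, in terms of the filtered initial error for any smaller
regularization parameter. -/
theorem norm_newtonIter_succ_sub_le {k : ℕ} (hδ : ∀ j < k + 1, δ ≤ γ * ‖u‖ * α j)
    (hball : ∀ j ≤ k + 1, newtonIter g α F F' x₀ y j ∈ Metric.ball xdag ρ)
    (h0 : ‖x₀ - xdag‖ ≤ 4 / 3 * ‖residualOp g (α 0) (F' xdag) (x₀ - xdag)‖)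
    (hf : ‖F (newtonIter g α F F' x₀ y (k + 1)) - y‖ ≤ τ * δ) {α' : ℝ} (hα'0 : 0 < α')
    (hα' : α' ≤ α k) :
    ‖newtonIter g α F F' x₀ y (k + 1) - xdag‖ ≤ (4 * c 5 + 4 * c 4) *
      (2 * ‖residualOp g α' (F' xdag) (x₀ - xdag)‖
        + (2 + 4 * c 2 * (τ + 4)) * ((√α')⁻¹ * δ)) := by
  have h4 := S.c_pos 4
  have h5 := S.c_pos 5
  have h2 := S.c_pos 2
  have hδ0 := S.delta_nonneg
  have hs := Real.sqrt_pos.2 (hα.pos k)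
  have hmem := hball k (by omega)
  have hK := S.norm_newtonIter_sub_le H hα hA hδ (fun j hj => hball j hj.le) k (by omega)
  have hE := S.norm_newtonIter_sub_le_residual H hα hA hδ hball h0 k (by omega)
  have hR := S.norm_residualOp_sub_residualOp_le hmem (hα.pos k)
  have htp := (norm_le_norm_add_norm_sub' (residualOp g (α k) (F' xdag) (x₀ - xdag))
    (residualOp g (α k) (F' (newtonIter g α F F' x₀ y k)) (x₀ - xdag))).trans
      (add_le_add le_rfl ((norm_sub_rev _ _).trans_le hR))
  obtain ⟨r1, r2, r3⟩ := H.final_step S.L_nonneg S.delta_nonneg hs (norm_nonneg _) (norm_nonneg _)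
    hK (by rw [Real.sq_sqrt (hα.pos k).le]; exact hδ k (by omega)) (norm_nonneg _) (norm_nonneg _)
    hE htp (S.norm_newtonStep_sub_le hmem (hα.pos k)) (S.sq_norm_residualOp_le hmem (hα.pos k))
    (S.norm_deriv_apply_residualOp_le hmem (hα.pos k) (hball (k + 1) le_rfl)) hf
  have hp := S.norm_residualOp_le_of_le hmem hα'0 hα'
  rw [newtonIter_succ]
  refine r1.trans (mul_le_mul_of_nonneg_left ?_ (by positivity))
  have hv : (√(α k))⁻¹ * δ ≤ (√α')⁻¹ * δ := by gcongr
  have hq := mul_le_mul_of_nonneg_left r3 (by positivity : 0 ≤ c 2 * (√α')⁻¹)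
  linarith

/-- A residual exceeding `τ δ` bounds the noise level by the smoothness term. -/
theorem noise_le_of_lt_residual {k : ℕ} (hδ : ∀ j < k, δ ≤ γ * ‖u‖ * α j)
    (hball : ∀ j ≤ k, newtonIter g α F F' x₀ y j ∈ Metric.ball xdag ρ)
    (h0 : ‖x₀ - xdag‖ ≤ 4 / 3 * ‖residualOp g (α 0) (F' xdag) (x₀ - xdag)‖)
    (h0' : ‖F' xdag (x₀ - xdag)‖
      ≤ 4 / 3 * ‖F' xdag (residualOp g (α 0) (F' xdag) (x₀ - xdag))‖)
    (hf : τ * δ < ‖F (newtonIter g α F F' x₀ y k) - y‖) {ν D w : ℝ} (hν : 0 ≤ ν) (hD : 0 ≤ D)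
    (hw : 0 ≤ w)
    (hR : ∀ a > 0, ‖residualOp g a (F' xdag) (x₀ - xdag)‖ ≤ D * a ^ ν * w)
    (hR' : ∀ a > 0, ‖F' xdag (residualOp g a (F' xdag) (x₀ - xdag))‖
      ≤ D * a ^ (ν + 1 / 2) * w) :
    (τ - 1) * δ ≤ 2 * (3 + 2 * c 5) * r ^ (ν + 1 / 2) * (D * α k ^ (ν + 1 / 2) * w) := by
  have h5 := S.c_pos 5
  have hδ0 := S.delta_nonneg
  have hr : 1 ≤ r ^ (ν + 1 / 2) := Real.one_le_rpow H.r_gt.le (by linarith)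
  have hr0 : 0 ≤ r := by linarith [H.r_gt]
  cases k with
  | zero =>
    have hm : x₀ ∈ Metric.ball xdag ρ := hball 0 le_rfl
    change τ * δ < ‖F x₀ - y‖ at hf
    have h1 := S.remainder' x₀ hm
    have h2 := S.noise'
    have h3 : ‖F x₀ - y‖ ≤ ‖F xdag - y‖ + ‖F' xdag (x₀ - xdag)‖
        + ‖F x₀ - F xdag - F' xdag (x₀ - xdag)‖ := by
      refine le_of_eq_of_le (congrArg _ ?_)
        ((norm_add_le _ _).trans (add_le_add (norm_add_le _ _) le_rfl))
      abel
    have h4 := mul_le_mul_of_nonneg_left S.norm_sub_sq_le S.L_nonneg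
    have h6 := mul_le_mul_of_nonneg_right H.eta_le (norm_nonneg (F' xdag (x₀ - xdag)))
    have h7 := hR' (α 0) (hα.pos 0)
    set W := D * α 0 ^ (ν + 1 / 2) * w with hW
    have hW0 : 0 ≤ W := (norm_nonneg _).trans h7
    have h8 : 6 * 1 * W ≤ 2 * (3 + 2 * c 5) * r ^ (ν + 1 / 2) * W := by
      gcongr
      linarith
    linarith
  | succ j =>
    have hs := Real.sqrt_pos.2 (hα.pos j)
    have hs' := Real.sqrt_pos.2 (hα.pos (j + 1))
    have hK := S.norm_newtonIter_sub_le H hα hA hδ (fun j hj => hball j hj.le)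
    have hE := S.norm_newtonIter_sub_le_residual H hα hA hδ hball h0
    have hT : ∀ i, √(α i) * ‖residualOp g (α i) (F' xdag) (x₀ - xdag)‖
        ≤ D * α i ^ (ν + 1 / 2) * w := fun i => by
      have := mul_le_mul_of_nonneg_left (hR (α i) (hα.pos i)) (Real.sqrt_nonneg (α i))
      rw [Real.rpow_add (hα.pos i), ← Real.sqrt_eq_rpow]
      linarith
    have hpj := (hα.pos j).le
    have hpj' := (hα.pos (j + 1)).le
    have hWW : D * α (j + 1) ^ (ν + 1 / 2) * w ≤ D * α j ^ (ν + 1 / 2) * w := by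
      have := hα.succ_le j
      gcongr
    have h1 := H.noise_le_step S.L_nonneg (norm_nonneg u) hδ0 hs hs' (norm_nonneg _)
      (norm_nonneg _) (hK j (by omega)) (hK (j + 1) le_rfl) (hT j) ((hT (j + 1)).trans hWW)
      (hR' (α j) (hα.pos j)) (by positivity) (hE j (by omega)) (hE (j + 1) le_rfl) hf
      (S.norm_image_newtonStep_sub_le_residual (hball j (by omega)) (hα.pos j)
        (hball (j + 1) le_rfl))
    refine h1.trans ?_
    have h2 : α j ^ (ν + 1 / 2) ≤ r ^ (ν + 1 / 2) * α (j + 1) ^ (ν + 1 / 2) := by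
      rw [← Real.mul_rpow hr0 hpj']
      exact Real.rpow_le_rpow hpj (hα.le_mul j) (by linarith)
    calc 2 * (3 + 2 * c 5) * (D * α j ^ (ν + 1 / 2) * w)
        ≤ 2 * (3 + 2 * c 5) * (D * (r ^ (ν + 1 / 2) * α (j + 1) ^ (ν + 1 / 2)) * w) := by gcongr
      _ = _ := by ring

/-- The rate at the stopping index: balance the two terms of the error bound, if the balancing
parameter is below the last parameter used; otherwise the last parameter itself will do, because it
cannot be small relative to the noise level. -/
theorem norm_newtonIter_sub_le_rate {k : ℕ} (hδ : ∀ j < k, δ ≤ γ * ‖u‖ * α j) (hδ0 : 0 < δ)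
    (hball : ∀ j ≤ k, newtonIter g α F F' x₀ y j ∈ Metric.ball xdag ρ)
    (h0 : ‖x₀ - xdag‖ ≤ 4 / 3 * ‖residualOp g (α 0) (F' xdag) (x₀ - xdag)‖)
    (h0' : ‖F' xdag (x₀ - xdag)‖
      ≤ 4 / 3 * ‖F' xdag (residualOp g (α 0) (F' xdag) (x₀ - xdag))‖)
    (hk : IsDiscrepancyIndex F (newtonIter g α F F' x₀ y) y τ δ k)
    {ν D w : ℝ} (hν : 0 < ν) (hD : 0 < D) (hw : 0 < w)
    (hR : ∀ a > 0, ‖residualOp g a (F' xdag) (x₀ - xdag)‖ ≤ D * a ^ ν * w)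
    (hR' : ∀ a > 0, ‖F' xdag (residualOp g a (F' xdag) (x₀ - xdag))‖
      ≤ D * a ^ (ν + 1 / 2) * w) :
    ‖newtonIter g α F F' x₀ y k - xdag‖ ≤
      (D + 2 * c 4 * (τ + 1) + (4 * c 5 + 4 * c 4) * (2 * D + (2 + 4 * c 2 * (τ + 4))
        * (1 + 2 * (3 + 2 * c 5) * r ^ (ν + 1 / 2) * D / (τ - 1))))
      * (w ^ (1 / (1 + 2 * ν)) * δ ^ (2 * ν / (1 + 2 * ν))) := by
  have h2 := S.c_pos 2
  have h4 := S.c_pos 4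
  have h5 := S.c_pos 5
  have hτ := H.tau_gt
  have hτ1 : 0 < τ - 1 := by linarith
  have hr0 : 0 < r := by linarith [H.r_gt]
  obtain ⟨a, ha0, hav, had⟩ := exists_balanced_parameter hν hw hδ0
  set R := w ^ (1 / (1 + 2 * ν)) * δ ^ (2 * ν / (1 + 2 * ν)) with hRdef
  have hRp : 0 < R := by positivity
  obtain ⟨P, hP⟩ : ∃ P, P = 2 * (3 + 2 * c 5) * r ^ (ν + 1 / 2) * D / (τ - 1) := ⟨_, rfl⟩
  have hP0 : 0 < P := by rw [hP]; positivity
  rw [← hP]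
  cases k with
  | zero =>
    have hm : x₀ ∈ Metric.ball xdag ρ := hball 0 le_rfl
    have hf : ‖F x₀ - y‖ ≤ τ * δ := hk.1
    have h1 := S.norm_deriv_apply_sub_le hm
    have h3 := mul_le_mul_of_nonneg_left S.norm_sub_sq_le S.L_nonneg
    have h6 := mul_le_mul_of_nonneg_right H.eta_le (norm_nonneg (F' xdag (x₀ - xdag)))
    have h7 : ‖F' xdag (x₀ - xdag)‖ ≤ 2 * (τ + 1) * δ := by linarith
    have h8 := S.gen.norm_le_residualOp_add S.norm_deriv_xdag_le ha0 (x₀ - xdag)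
    have h9 : c 4 * (√a)⁻¹ * ‖F' xdag (x₀ - xdag)‖ ≤ c 4 * (√a)⁻¹ * (2 * (τ + 1) * δ) := by
      gcongr
    have e1 : c 4 * (√a)⁻¹ * (2 * (τ + 1) * δ) = 2 * c 4 * (τ + 1) * R := by rw [← had]; ring
    have e2 : D * a ^ ν * w = D * R := by rw [← hav]; ring
    have h10 := hR a ha0
    change ‖x₀ - xdag‖ ≤ _
    have h11 : 0 ≤ (4 * c 5 + 4 * c 4) * (2 * D + (2 + 4 * c 2 * (τ + 4)) * (1 + P)) * R := by
      positivity
    linarith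
  | succ k =>
    -- it suffices to find a parameter for which both terms are of the optimal order
    suffices ∃ a, 0 < a ∧ a ≤ α k ∧ a ^ ν * w ≤ R ∧ (√a)⁻¹ * δ ≤ (1 + P) * R by
      obtain ⟨a, ha0, hak, hav, had⟩ := this
      have h1 := S.norm_newtonIter_succ_sub_le H hα hA hδ hball h0 hk.1 ha0 hak
      have h3 : ‖residualOp g a (F' xdag) (x₀ - xdag)‖ ≤ D * R :=
        (hR a ha0).trans (by rw [mul_assoc]; gcongr)
      have h6 : (4 * c 5 + 4 * c 4) * (2 * ‖residualOp g a (F' xdag) (x₀ - xdag)‖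
          + (2 + 4 * c 2 * (τ + 4)) * ((√a)⁻¹ * δ)) ≤ (4 * c 5 + 4 * c 4) * (2 * (D * R)
          + (2 + 4 * c 2 * (τ + 4)) * ((1 + P) * R)) := by gcongr
      have h7 : 0 ≤ (D + 2 * c 4 * (τ + 1)) * R := by positivity
      linarith
    rcases le_total a (α k) with hak | hak
    · exact ⟨a, ha0, hak, hav.le, by rw [had]; exact le_mul_of_one_le_left hRp.le (by linarith)⟩
    · have hpk := hα.pos k
      have h1 : α k ^ ν * w ≤ R := by
        rw [← hav]
        gcongr
      refine ⟨α k, hpk, le_rfl, h1, ?_⟩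
      have h3 := S.noise_le_of_lt_residual H hα hA (k := k) (fun j hj => hδ j (by omega))
        (fun j hj => hball j (by omega)) h0 h0' (hk.2 k (by omega)) hν.le hD.le hw.le hR hR'
      have h6 : δ ≤ P * (α k ^ ν * w) * √(α k) := by
        refine le_of_mul_le_mul_left (h3.trans_eq ?_) hτ1
        rw [hP, Real.rpow_add hpk, ← Real.sqrt_eq_rpow]
        field_simp
      have hs := Real.sqrt_pos.2 hpk
      rw [inv_mul_le_iff₀ hs]
      have h7 : P * (α k ^ ν * w) * √(α k) ≤ P * R * √(α k) := by gcongr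
      have h8 : 0 ≤ R * √(α k) := by positivity
      linarith

end NewtonSetting

end Sequence

end NewtonReg

theorem theorem2p1 (r τ : ℝ) (hr : 1 < r) (hτ : 1 < τ)
    (c : Fin 7 → ℝ) (hc : ∀ i, 0 < c i) (hc5 : 1 < c 5) :
    ∃ η₀ > 0, ∃ κ > 0, ∀ ν : ℝ, 1 / 2 ≤ ν → ∀ d > 0, ∃ C > 0,
      ∀ (𝕜 X Y : Type*) [RCLike 𝕜]
        [NormedAddCommGroup X] [InnerProductSpace 𝕜 X] [CompleteSpace X]
        [NormedAddCommGroup Y] [InnerProductSpace 𝕜 Y] [CompleteSpace Y]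
        -- the generator, its qualification, and the step sizes
        (g : ℝ → ℝ → ℝ) (νbar : ENNReal) (α : ℕ → ℝ)
        (_ : NewtonReg.GeneratorConditions g c)
        (_ : NewtonReg.CommutatorEstimates 𝕜 X Y g (c 6))
        (_ : NewtonReg.StepSizeConditions g α r (c 5))
        (_ : NewtonReg.IsQualification g νbar)
        (_ : ENNReal.ofReal (ν + 1 / 2) ≤ νbar)
        (_ : NewtonReg.RateBound g (ν + 1 / 2) d)
        -- the operator and its derivative
        (D : Set X) (F : X → Y) (F' : X → X →L[𝕜] Y) (xdag x₀ : X) (ρ L β₀ : ℝ)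
        (_ : ∀ x ∈ D, HasFDerivWithinAt F (F' x) D x)
        (_ : 0 < ρ) (_ : Metric.ball xdag ρ ⊆ D)
        (_ : 0 < β₀) (_ : β₀ ≤ 1 / 2)
        (_ : ∀ lam ∈ Set.Icc 0 β₀, 3 / 4 ≤ NewtonReg.residual g (α 0) lam)
        (_ : ∀ x ∈ Metric.ball xdag ρ, ‖F' x‖ ≤ min (c 3 * √(α 0)) (√β₀))
        (_ : ∀ x ∈ Metric.ball xdag ρ, ∀ z ∈ Metric.ball xdag ρ, ‖F' x - F' z‖ ≤ L * ‖x - z‖)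
        (_ : 4 * ‖x₀ - xdag‖ < ρ)
        -- the source condition
        (ω : X)
        (_ : x₀ - xdag = NewtonReg.funOp (fun t : ℝ => t ^ ν) (NewtonReg.gram (F' xdag)) ω),
        ∃ u : Y,
          (u ∈ (LinearMap.ker (ContinuousLinearMap.adjoint (F' xdag) : Y →ₗ[𝕜] X))ᗮ ∧
            x₀ - xdag = ContinuousLinearMap.adjoint (F' xdag) u) ∧
          (∀ v : Y, v ∈ (LinearMap.ker (ContinuousLinearMap.adjoint (F' xdag) : Y →ₗ[𝕜] X))ᗮ →
            x₀ - xdag = ContinuousLinearMap.adjoint (F' xdag) v → v = u) ∧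
          (L * ‖u‖ ≤ η₀ →
            ∀ δ > 0, ∀ yδ : Y, ‖yδ - F xdag‖ ≤ δ →
              -- for small noise the method is well defined up to the stopping index
              (‖u‖ * δ ≤ κ * ρ ^ 2 →
                ∃ k, NewtonReg.IsDiscrepancyIndex F
                    (NewtonReg.newtonIter g α F F' x₀ yδ) yδ τ δ k ∧
                  ∀ j ≤ k, NewtonReg.newtonIter g α F F' x₀ yδ j ∈ Metric.ball xdag ρ) ∧
              -- the error estimate at the stopping index
              (∀ k, NewtonReg.IsDiscrepancyIndex F
                  (NewtonReg.newtonIter g α F F' x₀ yδ) yδ τ δ k →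
                (∀ j ≤ k, NewtonReg.newtonIter g α F F' x₀ yδ j ∈ Metric.ball xdag ρ) →
                ‖NewtonReg.newtonIter g α F F' x₀ yδ k - xdag‖
                  ≤ C * ‖ω‖ ^ (1 / (1 + 2 * ν)) * δ ^ (2 * ν / (1 + 2 * ν)))) := by
  obtain ⟨γ, hγ, K, -, η₀, hη₀, hH⟩ := NewtonReg.exists_admissibleConstants hr hτ hc hc5
  have h2 := hc 2
  have h4 := hc 4
  have h5 := hc 5
  have hτ1 : 0 < τ - 1 := by linarith
  have hr0 : 0 < r := by linarith
  refine ⟨η₀, hη₀, 1 / (16 * c 4 ^ 2 * γ), by positivity, fun ν hν d hd => ?_⟩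
  have hν0 : 0 < ν := by linarith
  refine ⟨(d + 1) + 2 * c 4 * (τ + 1) + (4 * c 5 + 4 * c 4) * (2 * (d + 1)
    + (2 + 4 * c 2 * (τ + 4))
      * (1 + 2 * (3 + 2 * c 5) * r ^ (ν + 1 / 2) * (d + 1) / (τ - 1))), by positivity, ?_⟩
  intro 𝕜 X Y _ _ _ _ _ _ _ g νbar α hg hC hα _ _ hrate D F F' xdag x₀ ρ L β₀ hF hρ hD hβ₀ hβ₀'
    hrβ hbound hLip hx₀ ω hω
  obtain ⟨u, hu, hωu⟩ := NewtonReg.exists_adjoint_eq_rpow (F' xdag) hν ω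
  have hsrc : x₀ - xdag = ContinuousLinearMap.adjoint (F' xdag) u := hω.trans hωu
  refine ⟨u, ⟨hu, hsrc⟩, fun v hv hsv => NewtonReg.eq_of_adjoint_eq hu hv (hsv.symm.trans hsrc),
    fun hLu δ hδ yδ hyδ => ?_⟩
  have hmem : xdag ∈ Metric.ball xdag ρ := Metric.mem_ball_self hρ
  -- a negative `L` may be replaced by zero
  have hLip' : ∀ x ∈ Metric.ball xdag ρ, ∀ z ∈ Metric.ball xdag ρ,
      ‖F' x - F' z‖ ≤ max L 0 * ‖x - z‖ := fun x hx z hz =>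
    (hLip x hx z hz).trans (mul_le_mul_of_nonneg_right (le_max_left _ _) (norm_nonneg _))
  have S : NewtonReg.NewtonSetting g c F F' xdag x₀ ρ (max L 0) δ u yδ :=
    { c_pos := hc
      gen := hg
      comm := hC
      rho_pos := hρ
      L_nonneg := le_max_right _ _
      norm_deriv_le := fun x hx => by
        refine (hbound x hx).trans ((min_le_right _ _).trans ?_)
        rw [one_div, ← Real.sqrt_inv]
        exact Real.sqrt_le_sqrt (by linarith)
      lipschitz := hLip'
      remainder := fun x hx => (NewtonReg.norm_image_sub_sub_le_of_lipschitz_deriv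
        (le_max_right _ _) hF hD hLip' hx).1
      remainder' := fun x hx => (NewtonReg.norm_image_sub_sub_le_of_lipschitz_deriv
        (le_max_right _ _) hF hD hLip' hx).2
      source := hsrc
      noise := hyδ }
  have H : NewtonReg.AdmissibleConstants c r τ γ K (max L 0 * ‖u‖) := by
    refine hH _ (by positivity) ?_
    rw [max_mul_of_nonneg _ _ (norm_nonneg u), zero_mul]
    exact max_le hLu hη₀.le
  have hA : ‖F' xdag‖ ≤ c 3 * √(α 0) := (hbound xdag hmem).trans (min_le_left _ _)
  -- the comparison index
  have hex : ∃ n, γ * ‖u‖ * α n ≤ δ := by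
    have h := hα.tendsto_zero.const_mul (γ * ‖u‖)
    rw [mul_zero] at h
    exact (h.eventually (ge_mem_nhds hδ)).exists
  obtain ⟨n, hn, hnmin⟩ : ∃ n, γ * ‖u‖ * α n ≤ δ ∧ ∀ j < n, δ ≤ γ * ‖u‖ * α j := by
    classical
    exact ⟨Nat.find hex, Nat.find_spec hex, fun j hj => (not_le.1 (Nat.find_min hex hj)).le⟩
  constructor
  · intro hκ
    have hball := S.newtonIter_mem_ball H hα hA hnmin hx₀ hκ
    have hdisc : ∃ k, ‖F (NewtonReg.newtonIter g α F F' x₀ yδ k) - yδ‖ ≤ τ * δ :=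
      ⟨n, S.norm_image_newtonIter_sub_le H hα hA hnmin hn hball⟩
    classical
    refine ⟨Nat.find hdisc, ⟨Nat.find_spec hdisc, fun j hj => not_le.1 (Nat.find_min hdisc hj)⟩,
      fun j hj => hball j (hj.trans ?_)⟩
    exact Nat.find_min' hdisc (S.norm_image_newtonIter_sub_le H hα hA hnmin hn hball)
  · intro k hk hball
    -- the stopping index does not exceed the comparison index
    have hkn : k ≤ n := by
      by_contra! hlt
      have h1 := S.norm_image_newtonIter_sub_le H hα hA hnmin hn
        (fun j hj => hball j (hj.trans hlt.le))
      exact absurd (hk.2 n hlt) (not_lt.2 h1)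
    rcases eq_or_ne ω 0 with rfl | hω0
    · -- the initial guess is exact, and the iteration stops at once
      have hx : x₀ = xdag := sub_eq_zero.1 (by rw [hω, map_zero])
      have hk0 : k = 0 := by
        by_contra hne
        have h1 := hk.2 0 (Nat.pos_of_ne_zero hne)
        change τ * δ < ‖F x₀ - yδ‖ at h1
        have h3 := S.noise'
        rw [hx] at h1
        nlinarith
      subst hk0
      change ‖x₀ - xdag‖ ≤ _
      rw [hx, sub_self, norm_zero]
      positivity
    have hgram : ‖NewtonReg.gram (F' xdag)‖ ≤ β₀ := by
      rw [NewtonReg.norm_gram]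
      calc ‖F' xdag‖ ^ 2 ≤ √β₀ ^ 2 :=
            pow_le_pow_left₀ (norm_nonneg _) ((hbound xdag hmem).trans (min_le_right _ _)) 2
        _ = β₀ := Real.sq_sqrt hβ₀.le
    obtain ⟨h0, h0'⟩ := hg.norm_le_mul_residualOp S.norm_deriv_xdag_le (hα.pos 0)
      (a := 4 / 3) (by norm_num)
      (fun t ht => by linarith [hrβ t ⟨ht.1, ht.2.trans hgram⟩]) (x₀ - xdag)
    rw [mul_assoc]
    refine S.norm_newtonIter_sub_le_rate H hα hA (fun j hj => hnmin j (hj.trans_le hkn)) hδ hball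
      h0 h0' hk hν0 (by positivity) (norm_pos_iff.2 hω0) (fun a ha => ?_) (fun a ha => ?_)
    · rw [hω]
      exact hg.norm_residualOp_rpow_le hν0.le hrate hd.le S.norm_deriv_xdag_le ha ω
    · rw [hω]
      refine (hg.norm_apply_residualOp_rpow_le hν0.le hrate S.norm_deriv_xdag_le ha ω).trans ?_
      gcongr
      linarith
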